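/- For functions $\Psi,\omega:(0,\infty)\to(0,\infty)$ with $\Psi$ non-increasing and $\lim_{q\to\infty}\omega(q)=0$, let $W(\Psi)$ be the set of $x\in\mathbb R$ such that $|x-\frac pq|\le\Psi(q)$ for infinitely many $(p,q)\in\mathbb Z\times\mathbb N$ (where $\mathbb N=\{1,2,\dots\}$), and let $E(\Psi,\omega)$ be the set of $x\in W(\Psi)$ such that for all sufficiently large $q\in\mathbb N$ one has $|x-\frac pq|\ge(1-\omega(q))\Psi(q)$ for all $p\in\mathbb Z$. Let $\dim_H$ denote the Hausdorff dimension. Let $\Psi(q)=q^{-\tau_1}$ for some real $\tau_1>2$. Then the following statements are true. 1. If $\omega(q)=q^{-\tau_2}$ for some real $\tau_2$ with $0<\tau_2<\tau_1(\tau_1-2)$, then $\dim_H E(\Psi,\omega)=\frac{2}{\tau_1+\tau_2}$. 2. If $\tau_1$ is an integer, $\tau_1\ge 3$, and $\omega(q)=q^{-\tau_2}$ for some real $\tau_2$ with $0<\tau_2<\tau_1(\tau_1-1)$, then $\dim_H E(\Psi,\omega)=\frac{2}{\tau_1+\tau_2}$. 3. If $\tau_1$ is an integer, $\tau_1\ge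 3$, and $\omega(q)=Cq^{-\tau_1(\tau_1-1)}$ for some $C>\frac{45}{16}\cdot 8^{\tau_1}$, then $\dim_H E(\Psi,\omega)=\frac{2}{\tau_1^2}$. 4. If $\tau_1$ is an integer, $\tau_1\ge 3$, and $\omega(q)=cq^{-\tau_1(\tau_1-1)}$ for some $c\in(0,1)$, then $E(\Psi,\omega)=\emptyset$. -/

import Mathlib

open Filter

namespace ExactApprox

/-- The set `W(Ψ)` of `Ψ`-approximable real numbers: those `x` for which
`|x - p/q| ≤ Ψ(q)` holds for infinitely many pairs `(p, q)` with `p ∈ ℤ` and `q ≥ 1`.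
Only the values of `Ψ` at positive integers are used. -/
def wellApprox (Ψ : ℝ → ℝ) : Set ℝ :=
  {x | {pq : ℤ × ℕ | 0 < pq.2 ∧ |x - (pq.1 : ℝ) / (pq.2 : ℝ)| ≤ Ψ (pq.2 : ℝ)}.Infinite}

/-- The set `E(Ψ, ω)` of real numbers of exact `(Ψ, ω)`-order of approximation: those `x ∈ W(Ψ)`
such that for all sufficiently large `q ∈ ℕ` one has `|x - p/q| ≥ (1 - ω(q)) Ψ(q)` for every
integer `p`. -/
def exactOrder (Ψ ω : ℝ → ℝ) : Set ℝ :=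
  {x | x ∈ wellApprox Ψ ∧
    ∀ᶠ q : ℕ in atTop, ∀ p : ℤ, (1 - ω (q : ℝ)) * Ψ (q : ℝ) ≤ |x - (p : ℝ) / (q : ℝ)|}

end ExactApprox

/-!
Upper bound: a point of `E(Ψ, ω)` lies, for infinitely many `q`, within `ω(q) Ψ(q)` of some
`p / q ± Ψ(q)`. A bounded interval contains `O(q)` such centres, so if `ω(q) Ψ(q) ≪ q ^ (-σ)` the
natural covers give dimension at most `2 / σ`.

Lower bound, for `ω(q) = c q ^ (-τ₂)`: write `σ = τ₁ + τ₂` and attach to `r = p / q` a cell of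
length `≍ q ^ (-σ)` whose points `x` have `x - r` just below `q ^ (-τ₁)`. Because `τ₁ > 2`, the
points with a very good approximation of denominator beyond a suitable threshold `B q` fill only a
small part of the cell. By Dirichlet's theorem the remaining points are close to fractions of
denominator `≍ N`, which gives `≫ q ^ (-σ) N ^ 2` children whose cells avoid all denominators
between `B q` and their own; these numbers and separations of children make the dimension of the
limit set `2 / σ`. Denominators between `q` and `B q` are avoided by the whole cell, since a
fraction cannot be too close to `r`, nor, when `τ₁` is an integer, to `r + q ^ (-τ₁)`, which is
itself a fraction of denominator `q ^ τ₁`. The first repulsion reaches far enough if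
`τ₂ < τ₁ (τ₁ - 2)`; the second one extends the range up to `τ₂ = τ₁ (τ₁ - 1)`, where `c > 1` leaves
room for the cell at distance `q ^ (-τ₁ ^ 2)` from `r + q ^ (-τ₁)`.

At `τ₂ = τ₁ (τ₁ - 1)` the quantity `ω(q) Ψ(q)` is `c Ψ(q ^ τ₁)`, so for `c < 1` a point of
`E(Ψ, ω)` would be too close to the fraction `p / q ± q ^ (-τ₁)`, whose denominator is `q ^ τ₁`.
-/

namespace ExactApprox

open MeasureTheory
open scoped Topology NNReal ENNReal

theorem dimH_le_dimH_image_div {X Y : Type*} [EMetricSpace X] [EMetricSpace Y] {C r : ℝ≥0}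
    (hr : 0 < r) {g : X → Y} {S : Set X}
    (hg : ∀ x ∈ S, ∀ y ∈ S, edist x y ≤ C * edist (g x) (g y) ^ (r : ℝ)) :
    dimH S ≤ dimH (g '' S) / r := by
  rcases S.eq_empty_or_nonempty with rfl | ⟨x₀, -⟩
  · simp
  have : Nonempty X := ⟨x₀⟩
  have hinj : S.InjOn g := fun x hx y hy h => by
    simpa [h, ENNReal.zero_rpow_of_pos (NNReal.coe_pos.2 hr)] using hg x hx y hy
  have hinv : Set.LeftInvOn (Function.invFunOn g S) g S := hinj.leftInvOn_invFunOn
  have hholder : HolderOnWith C r (Function.invFunOn g S) (g '' S) := by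
    rintro _ ⟨x, hx, rfl⟩ _ ⟨y, hy, rfl⟩
    rw [hinv hx, hinv hy]
    exact hg x hx y hy
  simpa only [hinv.image_image] using hholder.dimH_image_le hr

theorem hausdorffMeasure_limsup_cofinite_eq_zero {X ι : Type*} [EMetricSpace X]
    [MeasurableSpace X] [BorelSpace X] [Countable ι] {d : ℝ} (hd : 0 < d) {t : ι → Set X}
    (ht : ∑' i, Metric.ediam (t i) ^ d ≠ ⊤) :
    μH[d] (limsup t cofinite) = 0 := by
  let tail (s : Finset ι) : ℝ≥0∞ := ∑' i : {i // i ∉ s}, Metric.ediam (t i) ^ d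
  have htail : Tendsto tail atTop (𝓝 0) := ENNReal.tendsto_tsum_compl_atTop_zero ht
  have hradius : Tendsto (fun s => tail s ^ d⁻¹) atTop (𝓝 0) := by
    simpa [ENNReal.zero_rpow_of_pos (inv_pos.2 hd)] using htail.ennrpow_const d⁻¹
  have hdiam (s : Finset ι) (i : {i // i ∉ s}) : Metric.ediam (t i) ≤ tail s ^ d⁻¹ := by
    rw [← ENNReal.rpow_rpow_inv hd.ne' (Metric.ediam (t i))]
    gcongr
    exact ENNReal.le_tsum i
  have hcover (s : Finset ι) : limsup t cofinite ⊆ ⋃ i : {i // i ∉ s}, t i := by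
    intro x hx
    rw [mem_limsup_iff_frequently_mem] at hx
    obtain ⟨i, hxi, his⟩ := (hx.and_eventually s.finite_toSet.eventually_cofinite_notMem).exists
    exact Set.mem_iUnion.2 ⟨⟨i, his⟩, hxi⟩
  have hle := Measure.hausdorffMeasure_le_liminf_tsum d _ _ hradius
    (fun s (i : {i // i ∉ s}) => t i) (.of_forall hdiam) (.of_forall hcover)
  exact le_antisymm (hle.trans_eq htail.liminf_eq) zero_le

theorem tsum_sigma_ediam_closedBall_ne_top {X : Type*} [PseudoMetricSpace X] {S : ℕ → Finset X}
    {A D d η σ : ℝ} (hA : 0 ≤ A) (hd : 0 ≤ d) (hησ : 1 + η < d * σ)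
    (hS : ∀ᶠ q in atTop, ((S q).card : ℝ) ≤ D * (q : ℝ) ^ η) :
    ∑' i : Σ q, S q, Metric.ediam (Metric.closedBall (i.2 : X) (A * (i.1 : ℝ) ^ (-σ))) ^ d ≠ ⊤ := by
  have hsummable : Summable fun q : ℕ => (S q).card * (2 * (A * (q : ℝ) ^ (-σ))) ^ d := by
    have hmajorant : Summable fun q : ℕ => D * (2 * A) ^ d * (q : ℝ) ^ (η - d * σ) :=
      (Real.summable_nat_rpow.2 (by linarith)).mul_left _
    refine hmajorant.of_norm_bounded_eventually_nat ?_
    filter_upwards [hS, eventually_gt_atTop 0] with q hq hq0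
    have hq0 : (0 : ℝ) < q := by exact_mod_cast hq0
    rw [Real.norm_of_nonneg (by positivity)]
    calc ((S q).card : ℝ) * (2 * (A * (q : ℝ) ^ (-σ))) ^ d
        ≤ D * (q : ℝ) ^ η * (2 * (A * (q : ℝ) ^ (-σ))) ^ d := by gcongr
      _ = D * (2 * A) ^ d * ((q : ℝ) ^ η * (q : ℝ) ^ (-σ * d)) := by
        rw [← mul_assoc 2, Real.mul_rpow (by positivity) (by positivity), ← Real.rpow_mul hq0.le]
        ring
      _ = D * (2 * A) ^ d * (q : ℝ) ^ (η - d * σ) := by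
        rw [← Real.rpow_add hq0]
        ring_nf
  refine ne_top_of_le_ne_top hsummable.tsum_ofReal_ne_top ?_
  rw [ENNReal.tsum_sigma']
  gcongr with q
  have hdiam (c : X) : Metric.ediam (Metric.closedBall c (A * (q : ℝ) ^ (-σ))) ^ d
      ≤ ENNReal.ofReal ((2 * (A * (q : ℝ) ^ (-σ))) ^ d) := by
    rw [← Metric.closedEBall_ofReal (by positivity),
      ← ENNReal.ofReal_rpow_of_nonneg (by positivity) hd, ENNReal.ofReal_mul two_pos.le,
      ENNReal.ofReal_ofNat]
    gcongr
    exact Metric.ediam_closedEBall_le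
  calc ∑' c : S q, Metric.ediam (Metric.closedBall (c : X) (A * (q : ℝ) ^ (-σ))) ^ d
      ≤ ∑' _ : S q, ENNReal.ofReal ((2 * (A * (q : ℝ) ^ (-σ))) ^ d) :=
        ENNReal.tsum_le_tsum fun c => hdiam c
    _ = ENNReal.ofReal ((S q).card * (2 * (A * (q : ℝ) ^ (-σ))) ^ d) := by
        rw [ENNReal.tsum_const, ENat.card_eq_coe_fintype_card, Fintype.card_coe,
          ENat.toENNReal_coe, ENNReal.ofReal_mul (Nat.cast_nonneg _), ENNReal.ofReal_natCast]

theorem dimH_setOf_frequently_exists_le {X : Type*} [MetricSpace X] {S : ℕ → Finset X}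
    {A D η σ : ℝ} (hA : 0 ≤ A) (hσ : 0 < σ)
    (hS : ∀ᶠ q in atTop, ((S q).card : ℝ) ≤ D * (q : ℝ) ^ η) :
    dimH {x | ∃ᶠ q : ℕ in atTop, ∃ c ∈ S q, dist x c ≤ A * (q : ℝ) ^ (-σ)}
      ≤ ENNReal.ofReal ((1 + η) / σ) := by
  borelize X
  let t (i : Σ q, S q) : Set X := Metric.closedBall (i.2 : X) (A * (i.1 : ℝ) ^ (-σ))
  have hlimsup : {x | ∃ᶠ q : ℕ in atTop, ∃ c ∈ S q, dist x c ≤ A * (q : ℝ) ^ (-σ)}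
      ⊆ limsup t cofinite := by
    intro x hx
    rw [mem_limsup_iff_frequently_mem, frequently_cofinite_iff_infinite]
    refine Set.Infinite.of_image Sigma.fst
      ((Nat.frequently_atTop_iff_infinite.1 hx).mono ?_)
    rintro q ⟨c, hc, hxc⟩
    exact ⟨⟨q, c, hc⟩, hxc, rfl⟩
  refine (dimH_mono hlimsup).trans (dimH_le fun d htop => ?_)
  by_contra! hlt
  have hd : 0 < (d : ℝ) := NNReal.coe_pos.2 (ENNReal.coe_pos.1 (zero_le.trans_lt hlt))
  have hησ : 1 + η < d * σ := by
    rw [← ENNReal.ofReal_coe_nnreal, ENNReal.ofReal_lt_ofReal_iff'] at hlt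
    exact (div_lt_iff₀ hσ).1 hlt.1
  have hnull : μH[d] (limsup t cofinite) = 0 :=
    hausdorffMeasure_limsup_cofinite_eq_zero hd
      (tsum_sigma_ediam_closedBall_ne_top hA hd.le hησ hS)
  exact ENNReal.zero_ne_top (hnull.symm.trans htop)

section CantorScheme

variable {X T : Type*} {J : T → Set X} {Child : T → T → Prop}

/-- The points lying in all the cells along some infinite path of the forest with vertices `T` and
parent-child relation `Child`, where `J t` is the cell of the vertex `t`. -/
def branchPoints (J : T → Set X) (Child : T → T → Prop) : Set X :=
  {x | ∃ t : ℕ → T, ∀ k, Child (t k) (t (k + 1)) ∧ x ∈ J (t k)}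

/-- A homogeneous tree inside the forest `(T, Child)`: every vertex of level `k` has `branching k`
children, and the cells of siblings are `gap k`-separated in their left-to-right order. The
children of the `a`-th vertex of level `k` are numbered by the `b` with `b / branching k = a`.
Only the numbers `a < ∏ i < k, branching i` matter at level `k`, but `node k` is total. -/
structure CantorScheme [PseudoMetricSpace X] (J : T → Set X) (Child : T → T → Prop) where
  branching : ℕ → ℕ
  node : ℕ → ℕ → T
  gap : ℕ → ℝ
  two_le_branching (k : ℕ) : 2 ≤ branching k
  gap_pos (k : ℕ) : 0 < gap k
  child (k a : ℕ) : Child (node k (a / branching k)) (node (k + 1) a)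
  gap_le_dist {k a b : ℕ} : a / branching k = b / branching k →
    ∀ x ∈ J (node (k + 1) a), ∀ y ∈ J (node (k + 1) b), |(a : ℝ) - b| * gap k ≤ dist x y

theorem abs_sub_le_abs_natFloor_sub_natFloor_add_one {x y : ℝ} (hx : 0 ≤ x) (hy : 0 ≤ y) :
    |x - y| ≤ |(⌊x⌋₊ : ℝ) - ⌊y⌋₊| + 1 := by
  have hx_lt := Nat.lt_floor_add_one x
  have hy_lt := Nat.lt_floor_add_one y
  have h_abs := abs_le.1 (le_refl |(⌊x⌋₊ : ℝ) - ⌊y⌋₊|)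
  exact abs_le.2 ⟨by linarith [Nat.floor_le hx], by linarith [Nat.floor_le hy]⟩

theorem abs_natCast_sub_le_of_div_eq {a b m : ℕ} (hm : 0 < m) (hab : a / m = b / m) :
    |(a : ℝ) - b| ≤ m := by
  have ha := Nat.div_add_mod a m
  have hb := Nat.div_add_mod b m
  have ha_lt := Nat.mod_lt a hm
  have hb_lt := Nat.mod_lt b hm
  rw [hab] at ha
  have : |(a : ℤ) - b| ≤ m := abs_le.2 ⟨by omega, by omega⟩
  exact_mod_cast this

namespace CantorScheme

section Address

variable [PseudoMetricSpace X] (S : CantorScheme J Child)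

/-- The number of vertices of level `k`. -/
def count (k : ℕ) : ℕ := ∏ i ∈ Finset.range k, S.branching i

/-- The vertex of level `k` attached to `t ∈ [0, 1)`: the `k`-th prefix of the mixed-radix expansion
of `t`, read as a natural number. -/
noncomputable def address (t : ℝ) (k : ℕ) : ℕ := ⌊S.count k * t⌋₊

theorem branching_pos (k : ℕ) : 0 < S.branching k := two_pos.trans_le (S.two_le_branching k)

theorem count_succ (k : ℕ) : S.count (k + 1) = S.count k * S.branching k :=
  Finset.prod_range_succ _ _

theorem two_pow_le_count (k : ℕ) : 2 ^ k ≤ S.count k := by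
  simpa [count] using Finset.pow_card_le_prod (Finset.range k) S.branching 2
    fun i _ => S.two_le_branching i

theorem count_pos (k : ℕ) : 0 < S.count k := (pow_pos two_pos k).trans_le (S.two_pow_le_count k)

theorem address_succ_div_branching (t : ℝ) (k : ℕ) :
    S.address t (k + 1) / S.branching k = S.address t k := by
  have hm : (S.branching k : ℝ) ≠ 0 := by exact_mod_cast (S.branching_pos k).ne'
  rw [address, address, ← Nat.floor_div_natCast, count_succ]
  congr 1
  push_cast
  field_simp

theorem address_zero {t : ℝ} (ht : t < 1) : S.address t 0 = 0 := by
  simp [address, count, ht]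

theorem count_mul_abs_sub_le {t u : ℝ} (ht : 0 ≤ t) (hu : 0 ≤ u) (k : ℕ) :
    S.count k * |t - u| ≤ |(S.address t k : ℝ) - S.address u k| + 1 := by
  rw [← abs_of_nonneg (Nat.cast_nonneg (α := ℝ) (S.count k)), ← abs_mul, mul_sub]
  exact abs_sub_le_abs_natFloor_sub_natFloor_add_one (by positivity) (by positivity)

theorem exists_address_eq_and_succ_ne {t u : ℝ} (ht : t ∈ Set.Ico 0 1) (hu : u ∈ Set.Ico 0 1)
    (htu : t ≠ u) :
    ∃ k, S.address t k = S.address u k ∧ S.address t (k + 1) ≠ S.address u (k + 1) := by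
  by_contra! hsucc
  have heq (k : ℕ) : S.address t k = S.address u k := by
    induction k with
    | zero => rw [S.address_zero ht.2, S.address_zero hu.2]
    | succ k ih => exact hsucc k ih
  obtain ⟨k, hk⟩ := pow_unbounded_of_one_lt (1 / |t - u|) (one_lt_two (α := ℝ))
  rw [div_lt_iff₀ (abs_pos.2 (sub_ne_zero.2 htu))] at hk
  have hpow : (2 : ℝ) ^ k ≤ S.count k := by exact_mod_cast S.two_pow_le_count k
  have hle := S.count_mul_abs_sub_le ht.1 hu.1 k
  rw [heq k, sub_self, abs_zero, zero_add] at hle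
  exact absurd hk (not_lt.2 ((mul_le_mul_of_nonneg_right hpow (abs_nonneg _)).trans hle))

theorem abs_sub_le_mul_dist_rpow {s C : ℝ} (hs : 0 < s) (hs1 : s ≤ 1)
    (hC : ∀ k, 2 / (S.count k : ℝ) ≤ C * (S.branching k * S.gap k) ^ s) {g : ℝ → X}
    (hg : ∀ t k, g t ∈ J (S.node k (S.address t k))) {t u : ℝ} (ht : t ∈ Set.Ico 0 1)
    (hu : u ∈ Set.Ico 0 1) (hC0 : 0 ≤ C) :
    |t - u| ≤ C * dist (g t) (g u) ^ s := by
  rcases eq_or_ne t u with rfl | htu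
  · simp [Real.zero_rpow hs.ne']
  obtain ⟨k, heq, hne⟩ := S.exists_address_eq_and_succ_ne ht hu htu
  have hsibling : S.address t (k + 1) / S.branching k = S.address u (k + 1) / S.branching k := by
    simp only [address_succ_div_branching, heq]
  have hm : (0 : ℝ) < S.branching k := by exact_mod_cast S.branching_pos k
  have hcount : (0 : ℝ) < S.count k := by exact_mod_cast S.count_pos k
  have hgap := S.gap_pos k
  have hdist := S.gap_le_dist hsibling _ (hg t (k + 1)) _ (hg u (k + 1))
  have hle := S.count_mul_abs_sub_le ht.1 hu.1 (k + 1)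
  have hDm := abs_natCast_sub_le_of_div_eq (S.branching_pos k) hsibling
  have hD1 : (1 : ℝ) ≤ |(S.address t (k + 1) : ℝ) - S.address u (k + 1)| := by
    exact_mod_cast Int.one_le_abs (sub_ne_zero.2 (Int.natCast_inj.ne.2 hne))
  set D : ℝ := |(S.address t (k + 1) : ℝ) - S.address u (k + 1)|
  rw [count_succ, Nat.cast_mul] at hle
  calc |t - u| ≤ 2 * D / (S.count k * S.branching k) := by
        rw [le_div_iff₀ (by positivity)]
        linarith
    _ = (D / S.branching k) * (2 / S.count k) := by field_simp
    _ ≤ (D / S.branching k) ^ s * (C * (S.branching k * S.gap k) ^ s) := by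
        gcongr
        · exact Real.self_le_rpow_of_le_one (by positivity) ((div_le_one hm).2 hDm) hs1
        · exact hC k
    _ = C * (D * S.gap k) ^ s := by
        rw [mul_left_comm, ← Real.mul_rpow (by positivity) (by positivity), ← mul_assoc,
          div_mul_cancel₀ _ hm.ne']
    _ ≤ C * dist (g t) (g u) ^ s := by gcongr

end Address

variable [MetricSpace X] (S : CantorScheme J Child)

theorem exists_mem_node_address (hcompact : ∀ t, IsCompact (J t)) (hnonempty : ∀ t, (J t).Nonempty)
    (hsub : ∀ t u, Child t u → J u ⊆ J t) (t : ℝ) : ∃ x, ∀ k, x ∈ J (S.node k (S.address t k)) := by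
  simpa only [Set.Nonempty, Set.mem_iInter] using
    IsCompact.nonempty_iInter_of_sequence_nonempty_isCompact_isClosed
      (fun k => J (S.node k (S.address t k)))
      (fun k => by
        have := hsub _ _ (S.child k (S.address t (k + 1)))
        rwa [S.address_succ_div_branching] at this)
      (fun _ => hnonempty _) (hcompact _) (fun _ => (hcompact _).isClosed)

theorem le_dimH_branchPoints {s C : ℝ} (hs : 0 < s) (hs1 : s ≤ 1)
    (hcompact : ∀ t, IsCompact (J t)) (hnonempty : ∀ t, (J t).Nonempty)
    (hsub : ∀ t u, Child t u → J u ⊆ J t)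
    (hC : ∀ k, 2 / (S.count k : ℝ) ≤ C * (S.branching k * S.gap k) ^ s) :
    ENNReal.ofReal s ≤ dimH (branchPoints J Child) := by
  choose g hg using S.exists_mem_node_address hcompact hnonempty hsub
  have hmem (t : ℝ) : g t ∈ branchPoints J Child := by
    refine ⟨fun k => S.node k (S.address t k), fun k => ⟨?_, hg t k⟩⟩
    simpa only [S.address_succ_div_branching] using S.child k (S.address t (k + 1))
  have hC0 : 0 ≤ C := by
    have hcount : (0 : ℝ) < S.count 0 := by exact_mod_cast S.count_pos 0
    have hgap := S.gap_pos 0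
    exact nonneg_of_mul_nonneg_left ((by positivity : 0 ≤ 2 / (S.count 0 : ℝ)).trans (hC 0))
      (by have := S.branching_pos 0; positivity)
  have hle : dimH (Set.Ico (0 : ℝ) 1) ≤ dimH (g '' Set.Ico 0 1) / s.toNNReal := by
    refine dimH_le_dimH_image_div (C := C.toNNReal) (Real.toNNReal_pos.2 hs) fun t ht u hu => ?_
    rw [edist_dist, edist_dist, Real.coe_toNNReal s hs.le,
      ENNReal.ofReal_rpow_of_nonneg dist_nonneg hs.le]
    refine (ENNReal.ofReal_le_ofReal
      (S.abs_sub_le_mul_dist_rpow hs hs1 hC hg ht hu hC0)).trans_eq (ENNReal.ofReal_mul hC0)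
  rw [Real.dimH_of_nonempty_interior (by simp), Module.finrank_self, Nat.cast_one,
    ENNReal.le_div_iff_mul_le (.inl (by simpa using hs)) (.inl ENNReal.coe_ne_top), one_mul] at hle
  exact hle.trans (dimH_mono (Set.image_subset_iff.2 fun t _ => hmem t))

end CantorScheme

end CantorScheme

section SeparatedChildren

variable {X T : Type*} [PseudoMetricSpace X] {J : T → Set X} {Child : T → T → Prop}
  {height : T → ℕ} {c : ℕ → ℝ} {s C : ℝ}

/-- The vertex `t` has `m` children in `U`, with cells that are `ε`-separated in their order. -/
def HasSeparatedChildren (J : T → Set X) (Child : T → T → Prop) (U : Set T) (m : ℕ) (ε : ℝ)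
    (t : T) : Prop :=
  ∃ f : Fin m → T, ∀ i, (Child t (f i) ∧ f i ∈ U) ∧
    ∀ j, ∀ x ∈ J (f i), ∀ y ∈ J (f j), |((i : ℕ) : ℝ) - (j : ℕ)| * ε ≤ dist x y

/-- One level of a Cantor scheme under construction: `size` vertices `node a`, of height at most
`bound`. The field `two_div_size_le` is the inequality that makes the mass distribution on the
limit set `s`-dimensional. -/
structure Level (height : T → ℕ) (c : ℕ → ℝ) (s C : ℝ) where
  bound : ℕ
  size : ℕ
  node : ℕ → T
  bound_pos : 0 < bound
  size_pos : 0 < size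
  height_le (a : ℕ) : height (node a) ≤ bound
  two_div_size_le : 2 / (size : ℝ) ≤ C * c bound ^ s

/-- The level `L'` is made of `m` separated children of every vertex of `L`; the cells of siblings
spread over a length at least `c L.bound`. -/
structure Level.Refines (J : T → Set X) (Child : T → T → Prop) (L L' : Level height c s C) (m : ℕ)
    (ε : ℝ) : Prop where
  two_le : 2 ≤ m
  gap_pos : 0 < ε
  size_eq : L'.size = L.size * m
  le_mul_gap : c L.bound ≤ m * ε
  child (a : ℕ) : Child (L.node (a / m)) (L'.node a)
  gap_le_dist {a b : ℕ} : a / m = b / m →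
    ∀ x ∈ J (L'.node a), ∀ y ∈ J (L'.node b), |(a : ℝ) - b| * ε ≤ dist x y

theorem eventually_two_div_mul_le {g : ℕ → ℝ} (hc : ∀ n, 0 < n → 0 < c n)
    (hg : Tendsto (fun N => g N * c N ^ s) atTop atTop) (hC : 0 < C) {n M : ℕ} (hn : 0 < n)
    (hM : 0 < M) :
    ∀ᶠ N in atTop, ∀ m : ℕ, c n * g N ≤ m → 2 / ((M * m : ℕ) : ℝ) ≤ C * c N ^ s := by
  have hcn := hc n hn
  filter_upwards [hg.eventually_ge_atTop (2 / (M * C * c n)), hg.eventually_gt_atTop 0,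
    eventually_gt_atTop 0] with N hN hgN hN0 m hm
  have hcN : 0 < c N ^ s := Real.rpow_pos_of_pos (hc N hN0) s
  have hgN : 0 < g N := pos_of_mul_pos_left hgN hcN.le
  have hm0 : (0 : ℝ) < m := (mul_pos hcn hgN).trans_le hm
  rw [div_le_iff₀ (by positivity)] at hN
  push_cast
  rw [div_le_iff₀ (by positivity)]
  calc 2 ≤ g N * c N ^ s * (M * C * c n) := hN
    _ = C * c N ^ s * (M * (c n * g N)) := by ring
    _ ≤ C * c N ^ s * (M * m) := by gcongr

theorem Level.exists_refines {g : ℕ → ℝ} (hc : ∀ n, 0 < n → 0 < c n)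
    (hg : Tendsto (fun N => g N * c N ^ s) atTop atTop) (hC : 0 < C)
    (hchildren : ∀ n, 0 < n → ∀ᶠ N in atTop, ∃ (m : ℕ) (ε : ℝ), 2 ≤ m ∧ 0 < ε ∧ c n * g N ≤ m ∧
      c n ≤ m * ε ∧ ∀ t, height t ≤ n → HasSeparatedChildren J Child {u | height u ≤ N} m ε t)
    (L : Level height c s C) : ∃ L' m ε, L.Refines J Child L' m ε := by
  obtain ⟨N, ⟨m, ε, hm, hε, hcm, hspread, hsep⟩, hsize, hN⟩ := ((hchildren _ L.bound_pos).and
    ((eventually_two_div_mul_le hc hg hC L.bound_pos L.size_pos).and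
      (eventually_gt_atTop 0))).exists
  have hm0 : 0 < m := by omega
  choose f hf using fun a => hsep (L.node a) (L.height_le a)
  let L' : Level height c s C :=
    { bound := N
      size := L.size * m
      node := fun a => f (a / m) ⟨a % m, Nat.mod_lt a hm0⟩
      bound_pos := hN
      size_pos := Nat.mul_pos L.size_pos hm0
      height_le := fun a => (hf _ _).1.2
      two_div_size_le := hsize m hcm }
  refine ⟨L', m, ε, hm, hε, rfl, hspread, fun a => (hf _ _).1.1, fun {a b} hab x hx y hy => ?_⟩
  have hdiff : (a : ℝ) - b = (a % m : ℕ) - (b % m : ℕ) := by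
    have ha : (m * (a / m : ℕ) + (a % m : ℕ) : ℝ) = a := by exact_mod_cast Nat.div_add_mod a m
    have hb : (m * (b / m : ℕ) + (b % m : ℕ) : ℝ) = b := by exact_mod_cast Nat.div_add_mod b m
    rw [← ha, ← hb, hab, add_sub_add_left_eq_sub]
  change y ∈ J (f (b / m) ⟨b % m, Nat.mod_lt b hm0⟩) at hy
  rw [← hab] at hy
  rw [hdiff]
  exact (hf _ _).2 ⟨b % m, Nat.mod_lt b hm0⟩ x hx y hy

/-- The Cantor scheme formed by a sequence of successive refinements. -/
noncomputable def CantorScheme.ofRefines {L : ℕ → Level height c s C} {m : ℕ → ℕ} {ε : ℕ → ℝ}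
    (h : ∀ k, (L k).Refines J Child (L (k + 1)) (m k) (ε k)) : CantorScheme J Child where
  branching := m
  node k := (L k).node
  gap := ε
  two_le_branching k := (h k).two_le
  gap_pos k := (h k).gap_pos
  child k := (h k).child
  gap_le_dist := (h _).gap_le_dist

theorem CantorScheme.size_mul_count_ofRefines {L : ℕ → Level height c s C} {m : ℕ → ℕ}
    {ε : ℕ → ℝ} (h : ∀ k, (L k).Refines J Child (L (k + 1)) (m k) (ε k)) (k : ℕ) :
    (L 0).size * (CantorScheme.ofRefines h).count k = (L k).size := by
  induction k with
  | zero => simp [count]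
  | succ k ih => rw [count_succ, ← mul_assoc, ih, (h k).size_eq]; rfl

end SeparatedChildren

theorem le_dimH_branchPoints_of_separatedChildren {X T : Type*} [MetricSpace X] [Nonempty T]
    {J : T → Set X} {Child : T → T → Prop} {height : T → ℕ} {c g : ℕ → ℝ} {s : ℝ} (hs : 0 < s)
    (hs1 : s ≤ 1) (hcompact : ∀ t, IsCompact (J t)) (hnonempty : ∀ t, (J t).Nonempty)
    (hsub : ∀ t u, Child t u → J u ⊆ J t) (hc : ∀ n, 0 < n → 0 < c n)
    (hg : Tendsto (fun N => g N * c N ^ s) atTop atTop)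
    (hchildren : ∀ n, 0 < n → ∀ᶠ N in atTop, ∃ (m : ℕ) (ε : ℝ), 2 ≤ m ∧ 0 < ε ∧ c n * g N ≤ m ∧
      c n ≤ m * ε ∧ ∀ t, height t ≤ n → HasSeparatedChildren J Child {u | height u ≤ N} m ε t) :
    ENNReal.ofReal s ≤ dimH (branchPoints J Child) := by
  obtain ⟨t₀⟩ := ‹Nonempty T›
  have hcs : 0 < c (height t₀ + 1) ^ s := Real.rpow_pos_of_pos (hc _ (Nat.succ_pos _)) s
  let L₀ : Level height c s (2 / c (height t₀ + 1) ^ s) :=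
    { bound := height t₀ + 1
      size := 1
      node := fun _ => t₀
      bound_pos := Nat.succ_pos _
      size_pos := one_pos
      height_le := fun _ => Nat.le_succ _
      two_div_size_le := by rw [Nat.cast_one, div_one, div_mul_cancel₀ _ hcs.ne'] }
  choose next m ε hnext using Level.exists_refines (J := J) (Child := Child) hc hg
    (div_pos two_pos hcs) hchildren
  let L (k : ℕ) := next^[k] L₀
  have hL (k : ℕ) : (L k).Refines J Child (L (k + 1)) (m (L k)) (ε (L k)) := by
    simpa only [L, Function.iterate_succ_apply'] using hnext (L k)
  refine (CantorScheme.ofRefines hL).le_dimH_branchPoints hs hs1 hcompact hnonempty hsub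
    (C := 2 / c (height t₀ + 1) ^ s) fun k => ?_
  have hcount : (CantorScheme.ofRefines hL).count k = (L k).size := by
    simpa [L, L₀] using CantorScheme.size_mul_count_ofRefines hL k
  rw [hcount]
  refine (L k).two_div_size_le.trans ?_
  have hcpos := hc _ (L k).bound_pos
  gcongr
  exact (hL k).le_mul_gap

section Rational

theorem one_div_mul_den_le_abs_div_sub {a : ℤ} {b : ℕ} {r : ℚ} (hb : 0 < b)
    (hne : (a : ℝ) / b ≠ r) : 1 / ((b : ℝ) * r.den) ≤ |(a : ℝ) / b - r| := by
  have hb' : (0 : ℝ) < b := by exact_mod_cast hb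
  have hq : (0 : ℝ) < r.den := by exact_mod_cast r.den_pos
  rw [Rat.cast_def] at hne ⊢
  rw [div_sub_div _ _ hb'.ne' hq.ne', abs_div, abs_of_pos (mul_pos hb' hq)]
  gcongr
  have hcross : a * r.den - b * r.num ≠ 0 := by
    rw [Ne, div_eq_div_iff hb'.ne' hq.ne'] at hne
    rw [sub_ne_zero, mul_comm (b : ℤ)]
    exact_mod_cast hne
  exact_mod_cast Int.one_le_abs hcross

theorem den_dvd_of_div_eq {r : ℚ} {a : ℤ} {b : ℕ} (h : (a : ℝ) / b = r) : r.den ∣ b := by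
  have hr : Rat.divInt a b = r := by
    rw [Rat.divInt_eq_div, Int.cast_natCast]
    exact_mod_cast h
  exact_mod_cast hr ▸ Rat.den_dvd a b

theorem rpow_neg_le_abs_sub_div {τ x : ℝ} {r : ℚ} {a : ℤ} {b : ℕ} (hb : 0 < b)
    (hne : (a : ℝ) / b ≠ r) (hx : |x - r| ≤ 1 / (2 * (b * r.den)))
    (hden : 2 * (r.den : ℝ) ≤ (b : ℝ) ^ (τ - 1)) : (b : ℝ) ^ (-τ) ≤ |x - (a : ℝ) / b| := by
  have hb' : (0 : ℝ) < b := by exact_mod_cast hb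
  have hsep := one_div_mul_den_le_abs_div_sub hb hne
  have htri := abs_sub_le ((a : ℝ) / b) x r
  rw [abs_sub_comm _ x] at htri
  have hhalf : 1 / ((b : ℝ) * r.den) = 1 / (2 * (b * r.den)) + 1 / (2 * (b * r.den)) := by
    field_simp
    norm_num
  calc (b : ℝ) ^ (-τ) = 1 / (b * (b : ℝ) ^ (τ - 1)) := by
        rw [Real.rpow_neg hb'.le, Real.rpow_sub_one hb'.ne', mul_div_cancel₀ _ hb'.ne', one_div]
    _ ≤ 1 / (b * (2 * r.den)) := by gcongr
    _ = 1 / (2 * (b * r.den)) := by ring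
    _ ≤ |x - (a : ℝ) / b| := by linarith

theorem den_add_inv_pow {r : ℚ} {n : ℕ} (hn : 2 ≤ n) :
    (r + ((r.den : ℚ) ^ n)⁻¹).den = r.den ^ n := by
  obtain ⟨k, rfl⟩ := Nat.exists_eq_add_of_le' hn
  have hq : (r.den : ℚ) ≠ 0 := by exact_mod_cast r.den_pos.ne'
  have hsum : r + ((r.den : ℚ) ^ (k + 2))⁻¹
      = ((r.num * r.den ^ (k + 1) + 1 : ℤ) : ℚ) / ((r.den ^ (k + 2) : ℕ) : ℤ) := by
    nth_rw 1 [← Rat.num_div_den r]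
    push_cast
    field_simp
    ring
  have hcoprime : IsCoprime (r.num * r.den ^ (k + 1) + 1) ((r.den : ℤ) ^ (k + 2)) :=
    IsCoprime.pow_right ⟨1, -(r.num * r.den ^ k), by ring⟩
  have hden := Rat.den_div_eq_of_coprime (a := r.num * r.den ^ (k + 1) + 1)
    (b := (r.den ^ (k + 2) : ℕ)) (by exact_mod_cast pow_pos r.den_pos _)
    (Int.isCoprime_iff_nat_coprime.1 (by exact_mod_cast hcoprime))
  rw [hsum]
  exact_mod_cast hden

theorem one_div_sq_le_sub {r r' : ℚ} (h : r < r') {N : ℕ} (hr : r.den ≤ N) (hr' : r'.den ≤ N) :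
    1 / (N : ℝ) ^ 2 ≤ (r' : ℝ) - r := by
  have hsep := one_div_mul_den_le_abs_div_sub (a := r'.num) (r := r) r'.den_pos (by
    rw [← Rat.cast_def]
    exact_mod_cast h.ne')
  rw [← Rat.cast_def, abs_of_pos (sub_pos.2 (by exact_mod_cast h))] at hsep
  refine le_trans ?_ hsep
  rw [sq]
  gcongr

theorem sub_div_sq_le_of_strictMono {m N : ℕ} {f : Fin m → ℚ} (hf : StrictMono f)
    (hden : ∀ i, (f i).den ≤ N) {i j : Fin m} (hij : i ≤ j) :
    ((j : ℝ) - i) / (N : ℝ) ^ 2 ≤ (f j : ℝ) - f i := by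
  obtain ⟨i, hi⟩ := i
  obtain ⟨j, hj⟩ := j
  obtain ⟨d, rfl⟩ := Nat.exists_eq_add_of_le (Fin.mk_le_mk.1 hij)
  clear hij
  induction d with
  | zero => simp
  | succ d ih =>
    have hprev := ih (by omega)
    have hstep := one_div_sq_le_sub (hf (a := ⟨i + d, by omega⟩) (b := ⟨i + (d + 1), hj⟩)
      (by simp)) (hden _) (hden _)
    push_cast at hprev ⊢
    rw [show (i : ℝ) + (d + 1) - i = (i + d - i) + 1 by ring, add_div]
    linarith

theorem card_le_of_den_le {F : Finset ℚ} {N : ℕ} (hN : 0 < N) {u l : ℝ} (hl : 0 ≤ l)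
    (hden : ∀ r ∈ F, r.den ≤ N) (hF : ∀ r ∈ F, (r : ℝ) ∈ Set.Icc u (u + l)) :
    (F.card : ℝ) ≤ l * (N : ℝ) ^ 2 + 1 := by
  rcases F.eq_empty_or_nonempty with rfl | hne
  · rw [Finset.card_empty, Nat.cast_zero]
    positivity
  have hcard : 0 < F.card := hne.card_pos
  let f := F.orderEmbOfFin rfl
  have hmem (i) : f i ∈ F := F.orderEmbOfFin_mem rfl i
  have hspread := sub_div_sq_le_of_strictMono f.strictMono (fun i => hden _ (hmem i))
    (i := ⟨0, hcard⟩) (j := ⟨F.card - 1, by omega⟩) (by simp)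
  have hlength := sub_le_sub (hF _ (hmem ⟨F.card - 1, by omega⟩)).2 (hF _ (hmem ⟨0, hcard⟩)).1
  rw [add_sub_cancel_left] at hlength
  have := (div_le_iff₀ (by positivity : (0 : ℝ) < (N : ℝ) ^ 2)).1 (hspread.trans hlength)
  push_cast [hcard] at this
  linarith

theorem finite_setOf_den_le {N : ℕ} (hN : 0 < N) (u : ℝ) {l : ℝ} (hl : 0 ≤ l) :
    {r : ℚ | r.den ≤ N ∧ (r : ℝ) ∈ Set.Icc u (u + l)}.Finite := by
  by_contra hinf
  obtain ⟨F, hF, hcard⟩ := Set.Infinite.exists_subset_card_eq hinf (⌊l * (N : ℝ) ^ 2 + 1⌋₊ + 1)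
  have hle := card_le_of_den_le hN hl (fun r hr => (hF hr).1) (fun r hr => (hF hr).2)
  rw [hcard, Nat.cast_succ] at hle
  exact hle.not_gt (Nat.lt_floor_add_one _)

theorem card_Icc_ceil_floor_le {u v : ℝ} (huv : u ≤ v) :
    ((Finset.Icc ⌈u⌉ ⌊v⌋).card : ℝ) ≤ v - u + 1 := by
  have hfloor := Int.floor_le v
  have hceil := Int.le_ceil u
  rw [Int.card_Icc]
  rcases le_total 0 (⌊v⌋ + 1 - ⌈u⌉) with h | h
  · rw [← Int.cast_natCast, Int.toNat_of_nonneg h]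
    push_cast
    linarith
  · rw [Int.toNat_of_nonpos h, Nat.cast_zero]
    linarith

theorem mem_Icc_ceil_floor_of_abs_sub_div_le {x δ u v : ℝ} {p : ℤ} {q : ℕ} (hq : 0 < q)
    (hx : x ∈ Set.Icc u v) (hp : |x - (p : ℝ) / q| ≤ δ) :
    p ∈ Finset.Icc ⌈(u - δ) * q⌉ ⌊(v + δ) * q⌋ := by
  have hq' : (0 : ℝ) < q := by exact_mod_cast hq
  rw [abs_le] at hp
  rw [Finset.mem_Icc, Int.ceil_le, Int.le_floor, ← le_div_iff₀ hq', ← div_le_iff₀ hq']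
  exact ⟨by linarith [hx.1], by linarith [hx.2]⟩

theorem abs_sub_add_le_or_abs_sub_sub_le {x c Ψ ω : ℝ} (hlo : (1 - ω) * Ψ ≤ |x - c|)
    (hhi : |x - c| ≤ Ψ) : |x - (c + Ψ)| ≤ ω * Ψ ∨ |x - (c - Ψ)| ≤ ω * Ψ := by
  rcases abs_cases (x - c) with ⟨h, -⟩ | ⟨h, -⟩ <;> rw [h] at hlo hhi
  · exact .inl (abs_le.2 ⟨by linarith, by linarith⟩)
  · exact .inr (abs_le.2 ⟨by linarith, by linarith⟩)

end Rational

section Volume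

/-- The points with an approximation of quality `2 b ^ (-τ)` by a fraction of denominator
`b ≥ B`. -/
def nearLargeDen (τ B : ℝ) : Set ℝ :=
  {x | ∃ (b : ℕ) (a : ℤ), B ≤ b ∧ |x - (a : ℝ) / b| < 2 * (b : ℝ) ^ (-τ)}

theorem volume_le_card_mul {α : Type*} {F : Finset α} {f : α → ℝ} {S : Set ℝ} {δ : ℝ}
    (hS : ∀ x ∈ S, ∃ c ∈ F, |x - f c| ≤ δ) : volume S ≤ ENNReal.ofReal (F.card * (2 * δ)) := by
  have hcover : S ⊆ ⋃ c ∈ F, Metric.closedBall (f c) δ := fun x hx => by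
    simpa only [Set.mem_iUnion, Metric.mem_closedBall, Real.dist_eq, exists_prop] using hS x hx
  calc volume S ≤ ∑ c ∈ F, volume (Metric.closedBall (f c) δ) :=
        (measure_mono hcover).trans (measure_biUnion_finset_le _ _)
    _ = ENNReal.ofReal (F.card * (2 * δ)) := by
        simp only [Real.volume_closedBall, Finset.sum_const, nsmul_eq_mul]
        rw [ENNReal.ofReal_mul (Nat.cast_nonneg F.card), ENNReal.ofReal_natCast]

theorem volume_Icc_inter_near_den_le {u l δ : ℝ} (hl : 0 ≤ l) (hδ : 0 ≤ δ) {N : ℕ} (hN : 0 < N) :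
    volume (Set.Icc u (u + l) ∩ {x | ∃ r : ℚ, r.den ≤ N ∧ |x - r| ≤ δ})
      ≤ ENNReal.ofReal (((l + 2 * δ) * (N : ℝ) ^ 2 + 1) * (2 * δ)) := by
  have hfin := finite_setOf_den_le hN (u - δ) (l := l + 2 * δ) (by positivity)
  have hcard : (hfin.toFinset.card : ℝ) ≤ (l + 2 * δ) * (N : ℝ) ^ 2 + 1 :=
    card_le_of_den_le (u := u - δ) hN (by positivity)
      (fun r hr => (hfin.mem_toFinset.1 hr).1) fun r hr => (hfin.mem_toFinset.1 hr).2
  refine (volume_le_card_mul (F := hfin.toFinset) (f := fun r : ℚ => (r : ℝ)) ?_).trans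
    (ENNReal.ofReal_le_ofReal (mul_le_mul_of_nonneg_right hcard (by positivity)))
  rintro x ⟨hx, r, hr, hxr⟩
  refine ⟨r, hfin.mem_toFinset.2 ⟨hr, ?_⟩, hxr⟩
  rw [abs_le] at hxr
  exact ⟨by linarith [hx.1], by linarith [hx.2]⟩

theorem volume_Icc_inter_dyadic_le {τ : ℝ} (hτ : 2 ≤ τ) (u : ℝ) {l R : ℝ} (hl : 0 ≤ l)
    (hR : 1 ≤ R) :
    volume (Set.Icc u (u + l) ∩ {x | ∃ r : ℚ, r.den ≤ ⌊2 * R⌋₊ ∧ |x - r| ≤ 2 * R ^ (-τ)})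
      ≤ ENNReal.ofReal (68 * (l * R ^ (2 - τ) + R ^ (-τ))) := by
  have hR0 : 0 < R := by linarith
  have hN : (⌊2 * R⌋₊ : ℝ) ≤ 2 * R := Nat.floor_le (by positivity)
  have hsplit : R ^ (2 - τ) = R ^ 2 * R ^ (-τ) := by
    rw [sub_eq_add_neg, Real.rpow_add hR0, Real.rpow_two]
  have hle_one : R ^ 2 * R ^ (-τ) ≤ 1 :=
    hsplit ▸ Real.rpow_le_one_of_one_le_of_nonpos hR (by linarith)
  refine (volume_Icc_inter_near_den_le hl (by positivity)
    (Nat.floor_pos.2 (by linarith))).trans (ENNReal.ofReal_le_ofReal ?_)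
  have hpos : 0 ≤ l * (R ^ 2 * R ^ (-τ)) := by positivity
  calc ((l + 2 * (2 * R ^ (-τ))) * (⌊2 * R⌋₊ : ℝ) ^ 2 + 1) * (2 * (2 * R ^ (-τ)))
      ≤ ((l + 2 * (2 * R ^ (-τ))) * (2 * R) ^ 2 + 1) * (2 * (2 * R ^ (-τ))) := by gcongr
    _ = 16 * (l * (R ^ 2 * R ^ (-τ))) + 64 * (R ^ 2 * R ^ (-τ)) * R ^ (-τ) + 4 * R ^ (-τ) := by
        ring
    _ ≤ 16 * (l * (R ^ 2 * R ^ (-τ))) + 64 * 1 * R ^ (-τ) + 4 * R ^ (-τ) := by gcongr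
    _ ≤ 68 * (l * R ^ (2 - τ) + R ^ (-τ)) := by
        rw [hsplit]
        linarith

theorem nearLargeDen_subset_iUnion {τ B : ℝ} (hτ : 0 ≤ τ) (hB : 0 < B) :
    nearLargeDen τ B ⊆ ⋃ j : ℕ,
      {x | ∃ r : ℚ, r.den ≤ ⌊2 * (2 ^ j * B)⌋₊ ∧ |x - r| ≤ 2 * (2 ^ j * B) ^ (-τ)} := by
  rintro x ⟨b, a, hb, hab⟩
  have hb0 : (0 : ℝ) < b := hB.trans_le hb
  obtain ⟨j, hj_le, hj_lt⟩ := exists_nat_pow_near ((one_le_div hB).2 hb) (one_lt_two (α := ℝ))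
  rw [le_div_iff₀ hB] at hj_le
  rw [div_lt_iff₀ hB, pow_succ] at hj_lt
  have hden : ((a : ℚ) / (b : ℕ)).den ≤ b :=
    Nat.le_of_dvd (by exact_mod_cast hb0) (den_dvd_of_div_eq (a := a) (by push_cast; rfl))
  have hpow : (b : ℝ) ^ (-τ) ≤ (2 ^ j * B) ^ (-τ) :=
    Real.rpow_le_rpow_of_nonpos (by positivity) hj_le (by linarith)
  refine Set.mem_iUnion.2 ⟨j, (a : ℚ) / (b : ℕ), hden.trans (Nat.le_floor (by linarith)), ?_⟩
  push_cast
  linarith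

theorem two_pow_mul_rpow_le {τ B l : ℝ} (hB : 0 < B) (j : ℕ) :
    l * (2 ^ j * B) ^ (2 - τ) + (2 ^ j * B) ^ (-τ)
      ≤ (l * B ^ (2 - τ) + B ^ (-τ)) * ((2 : ℝ) ^ (2 - τ)) ^ j := by
  have hpow : ((2 : ℝ) ^ j) ^ (2 - τ) = ((2 : ℝ) ^ (2 - τ)) ^ j :=
    (Real.rpow_pow_comm two_pos.le _ _).symm
  have hle : ((2 : ℝ) ^ j) ^ (-τ) ≤ ((2 : ℝ) ^ (2 - τ)) ^ j :=
    hpow ▸ Real.rpow_le_rpow_of_exponent_le (one_le_pow₀ one_le_two) (by linarith)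
  rw [Real.mul_rpow (by positivity) hB.le, Real.mul_rpow (by positivity) hB.le, hpow, add_mul,
    mul_left_comm, mul_comm (((2 : ℝ) ^ (2 - τ)) ^ j), mul_assoc l, mul_comm (B ^ (-τ))]
  gcongr

theorem exists_volume_Icc_inter_nearLargeDen_le {τ : ℝ} (hτ : 2 < τ) :
    ∃ K : ℝ, ∀ u l B : ℝ, 0 ≤ l → 1 ≤ B →
      volume (Set.Icc u (u + l) ∩ nearLargeDen τ B)
        ≤ ENNReal.ofReal (K * (l * B ^ (2 - τ) + B ^ (-τ))) := by
  have hlt_one : (2 : ℝ) ^ (2 - τ) < 1 :=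
    Real.rpow_lt_one_of_one_lt_of_neg one_lt_two (by linarith)
  refine ⟨68 * (1 - (2 : ℝ) ^ (2 - τ))⁻¹, fun u l B hl hB => ?_⟩
  have hB0 : 0 < B := by linarith
  have hgeometric := (hasSum_geometric_of_lt_one (by positivity) hlt_one).mul_left
    (68 * (l * B ^ (2 - τ) + B ^ (-τ)))
  have hterm (j : ℕ) := (volume_Icc_inter_dyadic_le hτ.le u hl
    (one_le_mul_of_one_le_of_one_le (one_le_pow₀ (one_le_two (α := ℝ)) (n := j)) hB)).trans
    (ENNReal.ofReal_le_ofReal (mul_le_mul_of_nonneg_left (two_pow_mul_rpow_le hB0 j)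
      (by norm_num)))
  calc volume (Set.Icc u (u + l) ∩ nearLargeDen τ B)
      ≤ ∑' j : ℕ, volume (Set.Icc u (u + l) ∩
          {x | ∃ r : ℚ, r.den ≤ ⌊2 * (2 ^ j * B)⌋₊ ∧ |x - r| ≤ 2 * (2 ^ j * B) ^ (-τ)}) := by
        refine (measure_mono ?_).trans (measure_iUnion_le _)
        rw [← Set.inter_iUnion]
        exact Set.inter_subset_inter_right _ (nearLargeDen_subset_iUnion (by linarith) hB0)
    _ ≤ ∑' j : ℕ, ENNReal.ofReal
          (68 * (l * B ^ (2 - τ) + B ^ (-τ)) * ((2 : ℝ) ^ (2 - τ)) ^ j) :=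
        ENNReal.tsum_le_tsum fun j => by simpa only [mul_assoc] using hterm j
    _ = ENNReal.ofReal
          (68 * (1 - (2 : ℝ) ^ (2 - τ))⁻¹ * (l * B ^ (2 - τ) + B ^ (-τ))) := by
        rw [← ENNReal.ofReal_tsum_of_nonneg (fun j => by positivity) hgeometric.summable,
          hgeometric.tsum_eq, mul_right_comm]

theorem volume_Icc_inter_near_div_le (u : ℝ) {l δ : ℝ} (hl : 0 ≤ l) (hδ : 0 ≤ δ) {q : ℕ}
    (hq : 0 < q) :
    volume (Set.Icc u (u + l) ∩ {x | ∃ p : ℤ, |x - (p : ℝ) / q| ≤ δ})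
      ≤ ENNReal.ofReal (((l + 2 * δ) * q + 1) * (2 * δ)) := by
  have hcard : ((Finset.Icc ⌈(u - δ) * q⌉ ⌊(u + l + δ) * q⌋).card : ℝ)
      ≤ (l + 2 * δ) * q + 1 := by
    refine (card_Icc_ceil_floor_le (by gcongr; linarith)).trans_eq ?_
    ring
  refine (volume_le_card_mul (F := Finset.Icc ⌈(u - δ) * q⌉ ⌊(u + l + δ) * q⌋)
    (f := fun p : ℤ => (p : ℝ) / q) ?_).trans
    (ENNReal.ofReal_le_ofReal (mul_le_mul_of_nonneg_right hcard (by positivity)))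
  rintro x ⟨hx, p, hp⟩
  exact ⟨p, mem_Icc_ceil_floor_of_abs_sub_div_le hq hx hp, hp⟩

theorem sum_range_inv_succ_le {M N : ℕ} (hMN : M ≤ N) :
    ∑ i ∈ Finset.range M, ((i + 1 : ℕ) : ℝ)⁻¹ ≤ 1 + Real.log N := by
  have hharmonic := harmonic_le_one_add_log N
  rw [harmonic] at hharmonic
  push_cast at hharmonic ⊢
  exact (Finset.sum_le_sum_of_subset_of_nonneg (Finset.range_mono hMN)
    fun _ _ _ => by positivity).trans hharmonic

theorem volume_Icc_inter_near_small_den_le (u : ℝ) {l : ℝ} (hl : 0 ≤ l) {N : ℕ} (hN : 0 < N) :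
    volume (Set.Icc u (u + l) ∩ {x | ∃ r : ℚ, 16 * r.den ≤ N ∧ |x - r| ≤ 1 / ((N : ℝ) * r.den)})
      ≤ ENNReal.ofReal (l / 8 + 6 * (1 + Real.log N) / N) := by
  have hN1 : (1 : ℝ) ≤ N := by exact_mod_cast hN
  let S (i : ℕ) : Set ℝ := Set.Icc u (u + l) ∩
    {x | ∃ p : ℤ, |x - (p : ℝ) / (i + 1 : ℕ)| ≤ 1 / ((N : ℝ) * (i + 1 : ℕ))}
  have hcover : Set.Icc u (u + l) ∩ {x | ∃ r : ℚ, 16 * r.den ≤ N ∧ |x - r| ≤ 1 / ((N : ℝ) * r.den)}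
      ⊆ ⋃ i ∈ Finset.range (N / 16), S i := by
    rintro x ⟨hx, r, hr, hxr⟩
    have hq := r.den_pos
    refine Set.mem_biUnion (x := r.den - 1) (Finset.mem_coe.2 (Finset.mem_range.2 (by omega)))
      ⟨hx, r.num, ?_⟩
    rwa [Nat.sub_add_cancel hq, ← Rat.cast_def]
  have hS (i : ℕ) : volume (S i) ≤ ENNReal.ofReal (2 * l / N + 6 / N * ((i + 1 : ℕ) : ℝ)⁻¹) := by
    refine (volume_Icc_inter_near_div_le u hl (by positivity) i.succ_pos).trans
      (ENNReal.ofReal_le_ofReal ?_)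
    calc _ = 2 * l / N + (4 / N + 2) / N * ((i + 1 : ℕ) : ℝ)⁻¹ := by
          field_simp
          ring
      _ ≤ 2 * l / N + (4 + 2) / N * ((i + 1 : ℕ) : ℝ)⁻¹ := by
          gcongr
          exact div_le_self (by norm_num) hN1
      _ = _ := by norm_num
  calc _ ≤ ∑ i ∈ Finset.range (N / 16), volume (S i) :=
        (measure_mono hcover).trans (measure_biUnion_finset_le _ _)
    _ ≤ ∑ i ∈ Finset.range (N / 16),
          ENNReal.ofReal (2 * l / N + 6 / N * ((i + 1 : ℕ) : ℝ)⁻¹) :=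
        Finset.sum_le_sum fun i _ => hS i
    _ = ENNReal.ofReal ((N / 16 : ℕ) * (2 * l / N) +
          6 / N * ∑ i ∈ Finset.range (N / 16), ((i + 1 : ℕ) : ℝ)⁻¹) := by
        rw [← ENNReal.ofReal_sum_of_nonneg fun i _ => by positivity, Finset.sum_add_distrib,
          ← Finset.mul_sum, Finset.sum_const, Finset.card_range, nsmul_eq_mul]
    _ ≤ ENNReal.ofReal (N / 16 * (2 * l / N) + 6 / N * (1 + Real.log N)) := by
        gcongr
        · exact_mod_cast Nat.cast_div_le
        · exact sum_range_inv_succ_le (Nat.div_le_self N 16)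
    _ = ENNReal.ofReal (l / 8 + 6 * (1 + Real.log N) / N) := by
        congr 1
        field_simp
        ring

theorem exists_rat_den_le_near {x : ℝ} {N : ℕ} (hN : 0 < N)
    (hx : ∀ r : ℚ, 16 * r.den ≤ N → 1 / ((N : ℝ) * r.den) < |x - r|) :
    ∃ r : ℚ, r.den ≤ N ∧ N < 16 * r.den ∧ |x - r| ≤ 16 / (N : ℝ) ^ 2 := by
  obtain ⟨r, hxr, hrN⟩ := Real.exists_rat_abs_sub_le_and_den_le x hN
  have hxr' : |x - r| ≤ 1 / ((N : ℝ) * r.den) := hxr.trans (by gcongr; linarith)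
  have hlarge : N < 16 * r.den := not_le.1 fun h => (hx r h).not_ge hxr'
  refine ⟨r, hrN, hlarge, hxr'.trans ?_⟩
  rw [div_le_div_iff₀ (by positivity) (by positivity), one_mul, sq, mul_left_comm]
  gcongr
  exact_mod_cast hlarge.le

theorem exists_finset_rat_near_compl {S : Set ℝ} {u l : ℝ} (hl : 0 < l)
    (hS : volume (Set.Icc u (u + l) ∩ S) ≤ ENNReal.ofReal (l / 4)) {N : ℕ} (hN : 0 < N)
    (hlog : 6 * (1 + Real.log N) / N ≤ l / 4) :
    ∃ F : Finset ℚ, l * (N : ℝ) ^ 2 / 128 ≤ F.card ∧ ∀ r ∈ F, r.den ≤ N ∧ N < 16 * r.den ∧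
      ∃ y ∈ Set.Icc u (u + l), y ∉ S ∧ |y - r| ≤ 16 / (N : ℝ) ^ 2 := by
  let T : Set ℚ := {r | r.den ≤ N ∧ N < 16 * r.den ∧
    ∃ y ∈ Set.Icc u (u + l), y ∉ S ∧ |y - r| ≤ 16 / (N : ℝ) ^ 2}
  have hfin : T.Finite := by
    refine (finite_setOf_den_le hN (u - 16 / (N : ℝ) ^ 2)
      (l := l + 2 * (16 / (N : ℝ) ^ 2)) (by positivity)).subset ?_
    rintro r ⟨hr, -, y, hy, -, hyr⟩
    rw [abs_le] at hyr
    exact ⟨hr, by linarith [hy.1], by linarith [hy.2]⟩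
  refine ⟨hfin.toFinset, ?_, fun r hr => hfin.mem_toFinset.1 hr⟩
  let S₂ : Set ℝ := {x | ∃ r : ℚ, 16 * r.den ≤ N ∧ |x - r| ≤ 1 / ((N : ℝ) * r.den)}
  let S₃ : Set ℝ := {x | ∃ r ∈ hfin.toFinset, |x - ((r : ℚ) : ℝ)| ≤ 16 / (N : ℝ) ^ 2}
  have hcover : Set.Icc u (u + l) ⊆ Set.Icc u (u + l) ∩ S ∪ (Set.Icc u (u + l) ∩ S₂ ∪ S₃) := by
    intro x hx
    by_cases hxS : x ∈ S
    · exact .inl ⟨hx, hxS⟩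
    by_cases hxS₂ : x ∈ S₂
    · exact .inr (.inl ⟨hx, hxS₂⟩)
    obtain ⟨r, hrN, hNr, hxr⟩ := exists_rat_den_le_near hN fun r hr =>
      not_le.1 fun h => hxS₂ ⟨r, hr, h⟩
    exact .inr (.inr ⟨r, hfin.mem_toFinset.2 ⟨hrN, hNr, x, hx, hxS, hxr⟩, hxr⟩)
  have hvol : ENNReal.ofReal l ≤ ENNReal.ofReal (l / 4) + (ENNReal.ofReal (l / 8 + l / 4) +
      ENNReal.ofReal (hfin.toFinset.card * (2 * (16 / (N : ℝ) ^ 2)))) := by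
    calc ENNReal.ofReal l = volume (Set.Icc u (u + l)) := by
          rw [Real.volume_Icc, add_sub_cancel_left]
      _ ≤ volume (Set.Icc u (u + l) ∩ S) + (volume (Set.Icc u (u + l) ∩ S₂) + volume S₃) :=
          (measure_mono hcover).trans <| (measure_union_le _ _).trans <|
            add_le_add_right (measure_union_le _ _) _
      _ ≤ _ := add_le_add hS <| add_le_add
          ((volume_Icc_inter_near_small_den_le u hl.le hN).trans
            (ENNReal.ofReal_le_ofReal (by linarith)))
          (volume_le_card_mul fun x hx => hx)
  rw [← ENNReal.ofReal_add (by positivity) (by positivity),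
    ← ENNReal.ofReal_add (by positivity) (by positivity),
    ENNReal.ofReal_le_ofReal_iff (by positivity)] at hvol
  have hcard : l / 4 ≤ 32 * hfin.toFinset.card / (N : ℝ) ^ 2 := by
    linarith [show (hfin.toFinset.card : ℝ) * (2 * (16 / (N : ℝ) ^ 2)) =
      32 * hfin.toFinset.card / (N : ℝ) ^ 2 by ring]
  rw [le_div_iff₀ (by positivity)] at hcard
  linarith

theorem eventually_log_div_le {δ : ℝ} (hδ : 0 < δ) :
    ∀ᶠ N : ℕ in atTop, 6 * (1 + Real.log N) / N ≤ δ := by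
  have hlog : Tendsto (fun x : ℝ => Real.log x / x) atTop (𝓝 0) :=
    Real.isLittleO_log_id_atTop.tendsto_div_nhds_zero
  have hlim := ((tendsto_inv_atTop_zero.add hlog).const_mul 6).comp
    (tendsto_natCast_atTop_atTop (R := ℝ))
  rw [add_zero, mul_zero] at hlim
  filter_upwards [hlim.eventually_le_const hδ] with N hN
  rwa [mul_div_assoc, add_div, one_div]

end Volume

section ExactOrder

/-- The point `x` satisfies the lower bound in the definition of `E(Ψ, ω)` at the denominator
`b`. -/
def AvoidsDen (Ψ ω : ℝ → ℝ) (x : ℝ) (b : ℕ) : Prop :=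
  ∀ a : ℤ, (1 - ω b) * Ψ b ≤ |x - (a : ℝ) / b|

variable {Ψ ω : ℝ → ℝ} {x : ℝ}

theorem AvoidsDen.of_le {b : ℕ} (hω : 0 ≤ ω b) (hΨ : 0 ≤ Ψ b)
    (h : ∀ a : ℤ, Ψ b ≤ |x - (a : ℝ) / b|) : AvoidsDen Ψ ω x b :=
  fun a => (mul_le_of_le_one_left hΨ (sub_le_self 1 hω)).trans (h a)

theorem mem_wellApprox_of_strictMono_den {r : ℕ → ℚ} (hr : StrictMono fun k => (r k).den)
    (hx : ∀ k, |x - r k| ≤ Ψ (r k).den) : x ∈ wellApprox Ψ := by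
  have hinj : Function.Injective fun k => ((r k).num, (r k).den) :=
    fun k l h => hr.injective (Prod.ext_iff.1 h).2
  refine (Set.infinite_range_of_injective hinj).mono ?_
  rintro _ ⟨k, rfl⟩
  exact ⟨(r k).den_pos, by simpa only [← Rat.cast_def] using hx k⟩

theorem mem_exactOrder_of_strictMono_den {r : ℕ → ℚ} (hr : StrictMono fun k => (r k).den)
    (hx : ∀ k, |x - r k| ≤ Ψ (r k).den)
    (havoid : ∀ k, ∀ b : ℕ, (r k).den ≤ b → b < (r (k + 1)).den → AvoidsDen Ψ ω x b) :
    x ∈ exactOrder Ψ ω := by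
  refine ⟨mem_wellApprox_of_strictMono_den hr hx, ?_⟩
  filter_upwards [eventually_ge_atTop (r 0).den] with b hb
  obtain ⟨k, hk, hk'⟩ :=
    hr.exists_between_of_tendsto_atTop hr.tendsto_atTop (Nat.lt_succ_of_le hb)
  exact havoid k b (Nat.le_of_lt_succ hk) hk'

end ExactOrder

section Scale

theorem eventually_forall_rpow_neg_le {τ : ℝ} (hτ : 2 < τ) : ∀ᶠ N : ℕ in atTop, ∀ q : ℕ,
    N < 16 * q → (q : ℝ) ^ (-τ) ≤ 1 / (2 * (N : ℝ) ^ 2) := by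
  have hlarge : ∀ᶠ N : ℕ in atTop, 2 * (16 : ℝ) ^ τ ≤ (N : ℝ) ^ (τ - 2) :=
    ((tendsto_rpow_atTop (by linarith)).comp tendsto_natCast_atTop_atTop).eventually_ge_atTop _
  filter_upwards [hlarge, eventually_gt_atTop 0] with N hN hN0 q hq
  have hN0' : (0 : ℝ) < N := by exact_mod_cast hN0
  have hq' : (N : ℝ) ≤ 16 * q := by exact_mod_cast hq.le
  calc (q : ℝ) ^ (-τ) ≤ (N / 16 : ℝ) ^ (-τ) :=
        Real.rpow_le_rpow_of_nonpos (by positivity) (by linarith) (by linarith)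
    _ = 16 ^ τ / ((N : ℝ) ^ (τ - 2) * N ^ 2) := by
        rw [Real.rpow_neg (by positivity), Real.div_rpow hN0'.le (by norm_num), inv_div,
          ← Real.rpow_two, ← Real.rpow_add hN0', sub_add_cancel]
    _ ≤ 16 ^ τ / (2 * 16 ^ τ * (N : ℝ) ^ 2) := by gcongr
    _ = 1 / (2 * (N : ℝ) ^ 2) := by
        field_simp

theorem eventually_forall_two_mul_le_rpow {τ : ℝ} (hτ : 2 < τ) : ∀ᶠ N : ℕ in atTop, ∀ b : ℕ,
    0 < b → (b : ℝ) ^ (-τ) ≤ 32 / (N : ℝ) ^ 2 → 2 * (N : ℝ) ≤ (b : ℝ) ^ (τ - 1) := by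
  have hτ0 : 0 < τ := by linarith
  have hexp : 0 < 2 * ((τ - 1) / τ) - 1 := by
    rw [sub_pos, mul_div_assoc', lt_div_iff₀ hτ0]
    linarith
  have hlarge : ∀ᶠ N : ℕ in atTop,
      2 * (32 : ℝ) ^ ((τ - 1) / τ) ≤ (N : ℝ) ^ (2 * ((τ - 1) / τ) - 1) :=
    ((tendsto_rpow_atTop hexp).comp tendsto_natCast_atTop_atTop).eventually_ge_atTop _
  filter_upwards [hlarge, eventually_gt_atTop 0] with N hN hN0 b hb hbN
  have hN0' : (0 : ℝ) < N := by exact_mod_cast hN0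
  have hb' : (0 : ℝ) < b := by exact_mod_cast hb
  have hpow : (N : ℝ) ^ 2 / 32 ≤ (b : ℝ) ^ τ := by
    rw [Real.rpow_neg hb'.le] at hbN
    simpa only [inv_div] using inv_le_of_inv_le₀ (by positivity) hbN
  rw [Real.rpow_sub_one hN0'.ne', le_div_iff₀ hN0'] at hN
  calc 2 * (N : ℝ) ≤ ((N : ℝ) ^ 2 / 32) ^ ((τ - 1) / τ) := by
        rw [Real.div_rpow (by positivity) (by norm_num), le_div_iff₀ (by positivity),
          ← Real.rpow_two, ← Real.rpow_mul hN0'.le]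
        linarith
    _ ≤ ((b : ℝ) ^ τ) ^ ((τ - 1) / τ) :=
        Real.rpow_le_rpow (by positivity) hpow (div_nonneg (by linarith) hτ0.le)
    _ = (b : ℝ) ^ (τ - 1) := by rw [← Real.rpow_mul hb'.le, mul_div_cancel₀ _ hτ0.ne']

theorem rpow_neg_le_abs_sub_div_of_notMem_nearLargeDen {τ B x y : ℝ} {r : ℚ} {b N : ℕ}
    (hb : 0 < b) (hbr : b < r.den) (hrN : r.den ≤ N) (hy : y ∉ nearLargeDen τ B) (hBb : B ≤ b)
    (hyr : |y - r| ≤ 16 / (N : ℝ) ^ 2) (hxr : |x - r| ≤ 1 / (2 * (N : ℝ) ^ 2))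
    (hscale : (b : ℝ) ^ (-τ) ≤ 32 / (N : ℝ) ^ 2 → 2 * (N : ℝ) ≤ (b : ℝ) ^ (τ - 1)) (a : ℤ) :
    (b : ℝ) ^ (-τ) ≤ |x - (a : ℝ) / b| := by
  have hN : 0 < N := r.den_pos.trans_le hrN
  rcases le_total ((b : ℝ) ^ (-τ)) (32 / (N : ℝ) ^ 2) with hsmall | hlarge
  · have hrN' : (r.den : ℝ) ≤ N := by exact_mod_cast hrN
    refine rpow_neg_le_abs_sub_div hb (fun h => ?_) (hxr.trans ?_) (by linarith [hscale hsmall])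
    · exact (Nat.le_of_dvd hb (den_dvd_of_div_eq h)).not_gt hbr
    · have hbN : (b : ℝ) ≤ N := by exact_mod_cast hbr.le.trans hrN
      rw [sq]
      gcongr
  · have hya : 2 * (b : ℝ) ^ (-τ) ≤ |y - (a : ℝ) / b| := not_lt.1 fun h => hy ⟨b, a, hBb, h⟩
    have htri : |y - (a : ℝ) / b| ≤ |y - r| + (|x - r| + |x - (a : ℝ) / b|) :=
      (abs_sub_le y r _).trans <| by
        have := abs_sub_le (r : ℝ) x (a / b)
        rw [abs_sub_comm (r : ℝ) x] at this
        linarith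
    have hhalf : 1 / (2 * (N : ℝ) ^ 2) ≤ 16 / (N : ℝ) ^ 2 := by
      rw [div_le_div_iff₀ (by positivity) (by positivity)]
      linarith [sq_nonneg (N : ℝ)]
    have hsum : 32 / (N : ℝ) ^ 2 = 16 / (N : ℝ) ^ 2 + 16 / (N : ℝ) ^ 2 := by ring
    linarith

end Scale

section Cells

/-- The interval attached to a rational number in the Cantor construction; its offset from the
rational number and its length depend on the denominator only. -/
def cell (α ℓ : ℕ → ℝ) (r : ℚ) : Set ℝ :=
  Set.Icc (r + α r.den) (r + α r.den + ℓ r.den)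

/-- The requirements on the cells of the rational numbers of denominator `q`: they lie within
`q ^ (-τ)` of their rational numbers, avoid the denominators between `q` and a threshold `B q`,
and few of their points have good approximations with denominators beyond this threshold. -/
structure AdmissibleDen (τ : ℝ) (ω : ℝ → ℝ) (α ℓ B : ℕ → ℝ) (q : ℕ) : Prop where
  omega_nonneg : 0 ≤ ω q
  offset_nonneg : 0 ≤ α q
  add_le : α q + ℓ q ≤ (q : ℝ) ^ (-τ)
  volume_le : ∀ u : ℝ, volume (Set.Icc u (u + ℓ q / 2) ∩ nearLargeDen τ (B q))
    ≤ ENNReal.ofReal (ℓ q / 8)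
  avoids : ∀ r : ℚ, r.den = q → ∀ x ∈ cell α ℓ r, ∀ b : ℕ, q ≤ b → b ≤ B q →
    AvoidsDen (fun q => q ^ (-τ)) ω x b

/-- The children of `r` are the rational numbers whose cells lie in the cell of `r` and avoid all
intermediate denominators. -/
def IsChild (τ : ℝ) (ω : ℝ → ℝ) (α ℓ : ℕ → ℝ) (r r' : ℚ) : Prop :=
  r.den < r'.den ∧ cell α ℓ r' ⊆ cell α ℓ r ∧
    ∀ x ∈ cell α ℓ r', ∀ b : ℕ, r.den ≤ b → b < r'.den → AvoidsDen (fun q => q ^ (-τ)) ω x b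

variable {τ : ℝ} {ω : ℝ → ℝ} {α ℓ B : ℕ → ℝ}

theorem AdmissibleDen.cell_subset_Icc {r : ℚ} {δ : ℝ} (hr : AdmissibleDen τ ω α ℓ B r.den)
    (hδ : (r.den : ℝ) ^ (-τ) ≤ δ) : cell α ℓ r ⊆ Set.Icc (r : ℝ) (r + δ) :=
  Set.Icc_subset_Icc (by linarith [hr.offset_nonneg]) (by linarith [hr.add_le])

theorem branchPoints_subset_exactOrder {q₀ : ℕ}
    (hadm : ∀ q, q₀ ≤ q → AdmissibleDen τ ω α ℓ B q) :
    branchPoints (fun r : {r : ℚ // q₀ ≤ r.den} => cell α ℓ r)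
      (fun r r' => IsChild τ ω α ℓ r r') ⊆ exactOrder (fun q => q ^ (-τ)) ω := by
  rintro x ⟨r, hr⟩
  refine mem_exactOrder_of_strictMono_den (r := fun k => r k)
    (strictMono_nat_of_lt_succ fun k => (hr k).1.1) (fun k => ?_)
    fun k => (hr k).1.2.2 x (hr (k + 1)).2
  have hx := (hadm _ (r k).2).cell_subset_Icc le_rfl (hr k).2
  rw [abs_of_nonneg (sub_nonneg.2 hx.1)]
  exact sub_le_iff_le_add'.2 hx.2

theorem IsChild.of_near {r r' : ℚ} {N : ℕ} {y : ℝ} (hr : AdmissibleDen τ ω α ℓ B r.den)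
    (hr' : AdmissibleDen τ ω α ℓ B r'.den) (hω : ∀ b : ℕ, r.den ≤ b → 0 ≤ ω b)
    (hrr' : r.den < r'.den) (hr'N : r'.den ≤ N)
    (hsmall : (r'.den : ℝ) ^ (-τ) ≤ 1 / (2 * (N : ℝ) ^ 2))
    (hscale : ∀ b : ℕ, 0 < b → (b : ℝ) ^ (-τ) ≤ 32 / (N : ℝ) ^ 2 →
      2 * (N : ℝ) ≤ (b : ℝ) ^ (τ - 1))
    (hℓ : 32 / (N : ℝ) ^ 2 ≤ ℓ r.den / 4)
    (hy : y ∈ Set.Icc (r + α r.den + ℓ r.den / 4) (r + α r.den + ℓ r.den / 4 + ℓ r.den / 2))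
    (hyB : y ∉ nearLargeDen τ (B r.den)) (hyr' : |y - r'| ≤ 16 / (N : ℝ) ^ 2) :
    IsChild τ ω α ℓ r r' := by
  have hcell := hr'.cell_subset_Icc hsmall
  have hsum : 32 / (N : ℝ) ^ 2 = 16 / (N : ℝ) ^ 2 + 31 * (1 / (2 * (N : ℝ) ^ 2)) +
    1 / (2 * (N : ℝ) ^ 2) := by ring
  have hpos : 0 ≤ 1 / (2 * (N : ℝ) ^ 2) := by positivity
  have hy' := abs_le.1 hyr'
  have hsub : cell α ℓ r' ⊆ cell α ℓ r := hcell.trans <|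
    Set.Icc_subset_Icc (by linarith [hy.1]) (by linarith [hy.2])
  refine ⟨hrr', hsub, fun x hx b hrb hbr' => ?_⟩
  rcases le_total (b : ℝ) (B r.den) with hbB | hBb
  · exact hr.avoids r rfl x (hsub hx) b hrb hbB
  have hx' : |x - r'| ≤ 1 / (2 * (N : ℝ) ^ 2) := by
    rw [abs_of_nonneg (sub_nonneg.2 (hcell hx).1)]
    exact sub_le_iff_le_add'.2 (hcell hx).2
  have hb : 0 < b := r.den_pos.trans_le hrb
  exact .of_le (hω b hrb) (by positivity) <|
    rpow_neg_le_abs_sub_div_of_notMem_nearLargeDen hb hbr' hr'N hyB hBb hyr' hx' (hscale b hb)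

theorem eventually_forall_exists_isChild (hτ : 2 < τ) {q₀ : ℕ}
    (hadm : ∀ q, q₀ ≤ q → AdmissibleDen τ ω α ℓ B q) (n : ℕ) {L : ℝ} (hL : 0 < L) :
    ∀ᶠ N : ℕ in atTop, ∀ r : ℚ, q₀ ≤ r.den → r.den ≤ n → L ≤ ℓ r.den →
      ∀ m : ℕ, m ≤ L * (N : ℝ) ^ 2 / 256 → ∃ f : Fin m → ℚ, StrictMono f ∧ ∀ i,
        (f i).den ≤ N ∧ (((f i).den : ℝ) ^ (-τ) ≤ 1 / (2 * (N : ℝ) ^ 2)) ∧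
          IsChild τ ω α ℓ r (f i) := by
  have hsq : ∀ᶠ N : ℕ in atTop, 32 / (N : ℝ) ^ 2 ≤ L / 4 :=
    (tendsto_const_nhds.div_atTop ((tendsto_pow_atTop two_ne_zero).comp
      tendsto_natCast_atTop_atTop)).eventually_le_const (by positivity)
  filter_upwards [eventually_forall_rpow_neg_le hτ, eventually_forall_two_mul_le_rpow hτ,
    eventually_log_div_le (show 0 < L / 8 by positivity), hsq, eventually_ge_atTop (16 * n),
    eventually_gt_atTop 0] with N hsmall hscale hlog hN32 hnN hN r hr hrn hLr m hm
  have hvol := (hadm _ hr).volume_le (r + α r.den + ℓ r.den / 4)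
  rw [show ℓ r.den / 8 = ℓ r.den / 2 / 4 by ring] at hvol
  obtain ⟨F, hcard, hF⟩ := exists_finset_rat_near_compl (by linarith) hvol hN
    (hlog.trans (by linarith))
  have hmF : m ≤ F.card := by
    have hLN : L * (N : ℝ) ^ 2 / 256 ≤ ℓ r.den * (N : ℝ) ^ 2 / 256 := by gcongr
    exact_mod_cast hm.trans (by linarith : L * (N : ℝ) ^ 2 / 256 ≤ F.card)
  refine ⟨F.orderEmbOfCardLe hmF, (F.orderEmbOfCardLe hmF).strictMono, fun i => ?_⟩
  obtain ⟨hden, hlarge, y, hy, hyB, hyr'⟩ := hF _ (F.orderEmbOfCardLe_mem hmF i)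
  have hrr' : r.den < (F.orderEmbOfCardLe hmF i).den := by omega
  exact ⟨hden, hsmall _ hlarge, .of_near (hadm _ hr) (hadm _ (hr.trans hrr'.le))
    (fun b hb => (hadm b (hr.trans hb)).omega_nonneg) hrr' hden (hsmall _ hlarge) hscale
    (hN32.trans (by linarith)) hy hyB hyr'⟩

theorem mul_one_div_le_dist_of_strictMono {m N : ℕ} (hN : 0 < N) {f : Fin m → ℚ}
    (hf : StrictMono f) (hden : ∀ i, (f i).den ≤ N) {i j : Fin m} {x y : ℝ}
    (hx : x ∈ Set.Icc (f i : ℝ) (f i + 1 / (2 * (N : ℝ) ^ 2)))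
    (hy : y ∈ Set.Icc (f j : ℝ) (f j + 1 / (2 * (N : ℝ) ^ 2))) :
    |((i : ℕ) : ℝ) - (j : ℕ)| * (1 / (2 * (N : ℝ) ^ 2)) ≤ dist x y := by
  wlog hij : i ≤ j generalizing i j x y with H
  · rw [abs_sub_comm, dist_comm]
    exact H hy hx (le_of_not_ge hij)
  rcases hij.eq_or_lt with rfl | hlt
  · simp
  have hspread := sub_div_sq_le_of_strictMono hf hden hij
  have hone : (1 : ℝ) ≤ ((j : ℕ) : ℝ) - (i : ℕ) :=
    le_sub_iff_add_le'.2 (by exact_mod_cast hlt)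
  have hstep := mul_le_mul_of_nonneg_right hone (by positivity : 0 ≤ 1 / (2 * (N : ℝ) ^ 2))
  have hsplit : (((j : ℕ) : ℝ) - (i : ℕ)) / (N : ℝ) ^ 2 =
      2 * ((((j : ℕ) : ℝ) - (i : ℕ)) * (1 / (2 * (N : ℝ) ^ 2))) := by ring
  rw [abs_sub_comm, abs_of_nonneg (by linarith), dist_comm, Real.dist_eq]
  refine le_trans ?_ (le_abs_self _)
  linarith [hx.2, hy.1]

theorem tendsto_sq_mul_const_mul_rpow_rpow {c σ s : ℝ} (hc : 0 < c) (hs : s * σ < 2) :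
    Tendsto (fun N : ℕ => (N : ℝ) ^ 2 * (c * (N : ℝ) ^ (-σ)) ^ s) atTop atTop := by
  refine (((tendsto_rpow_atTop (sub_pos.2 hs)).comp tendsto_natCast_atTop_atTop).const_mul_atTop
    (Real.rpow_pos_of_pos hc s)).congr' ?_
  filter_upwards [eventually_gt_atTop 0] with N hN
  have hN' : (0 : ℝ) < N := by exact_mod_cast hN
  rw [Function.comp_apply, Real.mul_rpow hc.le (by positivity), ← Real.rpow_mul hN'.le,
    sub_eq_add_neg, Real.rpow_add hN', Real.rpow_two, mul_left_comm, neg_mul, mul_comm σ]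

theorem eventually_exists_hasSeparatedChildren {κ σ : ℝ} (hτ : 2 < τ) (hκ : 0 < κ) (hσ : 0 ≤ σ)
    {q₀ : ℕ} (hadm : ∀ q, q₀ ≤ q → AdmissibleDen τ ω α (fun q => κ * (q : ℝ) ^ (-σ)) B q)
    {n : ℕ} (hn : 0 < n) :
    ∀ᶠ N : ℕ in atTop, ∃ (m : ℕ) (ε : ℝ), 2 ≤ m ∧ 0 < ε ∧
      κ / 1024 * (n : ℝ) ^ (-σ) * (N : ℝ) ^ 2 ≤ m ∧ κ / 1024 * (n : ℝ) ^ (-σ) ≤ m * ε ∧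
      ∀ r : {r : ℚ // q₀ ≤ r.den}, r.1.den ≤ n → HasSeparatedChildren
        (fun r : {r : ℚ // q₀ ≤ r.den} => cell α (fun q => κ * (q : ℝ) ^ (-σ)) r)
        (fun r r' => IsChild τ ω α (fun q => κ * (q : ℝ) ^ (-σ)) r r')
        {r | r.1.den ≤ N} m ε r := by
  have hL : 0 < κ * (n : ℝ) ^ (-σ) := by positivity
  have hlarge : ∀ᶠ N : ℕ in atTop, 512 ≤ κ * (n : ℝ) ^ (-σ) * (N : ℝ) ^ 2 :=
    (((tendsto_pow_atTop two_ne_zero).comp tendsto_natCast_atTop_atTop).const_mul_atTop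
      hL).eventually_ge_atTop _
  filter_upwards [eventually_forall_exists_isChild hτ hadm n hL, hlarge, eventually_gt_atTop 0]
    with N hchildren hNlarge hN
  have hfloor := Nat.lt_floor_add_one (κ * (n : ℝ) ^ (-σ) * (N : ℝ) ^ 2 / 256)
  refine ⟨⌊κ * (n : ℝ) ^ (-σ) * (N : ℝ) ^ 2 / 256⌋₊, 1 / (2 * (N : ℝ) ^ 2),
    Nat.le_floor (by push_cast; linarith), by positivity, by linarith, ?_, fun r hrn => ?_⟩
  · rw [mul_one_div, le_div_iff₀ (by positivity)]
    linarith
  · have hLr : κ * (n : ℝ) ^ (-σ) ≤ κ * (r.1.den : ℝ) ^ (-σ) :=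
      mul_le_mul_of_nonneg_left (Real.rpow_le_rpow_of_nonpos (by exact_mod_cast r.1.den_pos)
        (by exact_mod_cast hrn) (neg_nonpos.2 hσ)) hκ.le
    obtain ⟨f, hf, hchild⟩ := hchildren r r.2 hrn hLr _ (Nat.floor_le (by positivity))
    have hf₀ (i) : q₀ ≤ (f i).den := r.2.trans (hchild i).2.2.1.le
    have hcell (i) := (hadm _ (hf₀ i)).cell_subset_Icc (hchild i).2.1
    exact ⟨fun i => ⟨f i, hf₀ i⟩, fun i => ⟨⟨(hchild i).2.2, (hchild i).1⟩, fun j x hx y hy =>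
      mul_one_div_le_dist_of_strictMono hN hf (fun i => (hchild i).1) (hcell i hx) (hcell j hy)⟩⟩

theorem le_dimH_exactOrder_of_admissibleDen {κ σ : ℝ} (hτ : 2 < τ) (hκ : 0 < κ) (hσ : 2 ≤ σ)
    (hadm : ∀ᶠ q in atTop, AdmissibleDen τ ω α (fun q => κ * (q : ℝ) ^ (-σ)) B q) :
    ENNReal.ofReal (2 / σ) ≤ dimH (exactOrder (fun q => q ^ (-τ)) ω) := by
  obtain ⟨q₀, hq₀⟩ := eventually_atTop.1 hadm
  refine ENNReal.le_of_forall_nnreal_lt fun s hs => ?_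
  rcases eq_or_ne s 0 with rfl | hs0
  · exact bot_le
  rw [← ENNReal.ofReal_coe_nnreal,
    ENNReal.ofReal_lt_ofReal_iff_of_nonneg s.coe_nonneg, lt_div_iff₀ (by linarith)] at hs
  have hs1 : (s : ℝ) ≤ 1 := by nlinarith [s.coe_nonneg]
  have : Nonempty {r : ℚ // q₀ ≤ r.den} :=
    ⟨((q₀ + 1 : ℕ) : ℚ)⁻¹, by rw [Rat.inv_natCast_den_of_pos q₀.succ_pos]; exact q₀.le_succ⟩
  rw [← ENNReal.ofReal_coe_nnreal]
  refine (le_dimH_branchPoints_of_separatedChildren (height := fun r => r.1.den)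
    (c := fun n => κ / 1024 * (n : ℝ) ^ (-σ)) (g := fun N => (N : ℝ) ^ 2)
    (NNReal.coe_pos.2 (pos_iff_ne_zero.2 hs0)) hs1 (fun r => isCompact_Icc)
    (fun r => Set.nonempty_Icc.2 (le_add_of_nonneg_right (by positivity)))
    (fun r r' h => h.2.1) (fun n hn => by positivity)
    (tendsto_sq_mul_const_mul_rpow_rpow (by positivity) hs)
    (fun n hn => eventually_exists_hasSeparatedChildren hτ hκ (by linarith) hq₀ hn)).trans
    (dimH_mono (branchPoints_subset_exactOrder hq₀))

theorem eventually_volume_Icc_inter_nearLargeDen_le {κ σ : ℝ} (hτ : 2 < τ) (hκ : 0 < κ)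
    (hB : Tendsto B atTop atTop)
    (hBσ : Tendsto (fun q : ℕ => B q ^ (-τ) * (q : ℝ) ^ σ) atTop (𝓝 0)) :
    ∀ᶠ q : ℕ in atTop, ∀ u : ℝ,
      volume (Set.Icc u (u + κ * (q : ℝ) ^ (-σ) / 2) ∩ nearLargeDen τ (B q))
        ≤ ENNReal.ofReal (κ * (q : ℝ) ^ (-σ) / 8) := by
  obtain ⟨K, hK⟩ := exists_volume_Icc_inter_nearLargeDen_le hτ
  have hlong : Tendsto (fun q => K * B q ^ (2 - τ)) atTop (𝓝 0) := by
    simpa only [neg_sub, mul_zero, Function.comp_apply] using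
      ((tendsto_rpow_neg_atTop (sub_pos.2 hτ)).comp hB).const_mul K
  have hshort : Tendsto (fun q : ℕ => K * (B q ^ (-τ) * (q : ℝ) ^ σ)) atTop (𝓝 0) := by
    simpa only [mul_zero] using hBσ.const_mul K
  filter_upwards [hB.eventually_ge_atTop 1, eventually_gt_atTop 0,
    hlong.eventually_le_const (show (0 : ℝ) < 1 / 8 by norm_num),
    hshort.eventually_le_const (show 0 < κ / 16 by positivity)] with q hB1 hq h₁ h₂ u
  have hq' : (0 : ℝ) < q := by exact_mod_cast hq
  refine (hK u _ _ (by positivity) hB1).trans (ENNReal.ofReal_le_ofReal ?_)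
  calc K * (κ * (q : ℝ) ^ (-σ) / 2 * B q ^ (2 - τ) + B q ^ (-τ))
      = κ * (q : ℝ) ^ (-σ) / 2 * (K * B q ^ (2 - τ)) +
          (q : ℝ) ^ (-σ) * (K * (B q ^ (-τ) * (q : ℝ) ^ σ)) := by
        rw [Real.rpow_neg hq'.le σ]
        field_simp
    _ ≤ κ * (q : ℝ) ^ (-σ) / 2 * (1 / 8) + (q : ℝ) ^ (-σ) * (κ / 16) := by gcongr
    _ = κ * (q : ℝ) ^ (-σ) / 8 := by ring

theorem le_dimH_exactOrder {κ σ : ℝ} (hτ : 2 < τ) (hκ : 0 < κ) (hσ : 2 ≤ σ)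
    (hω : ∀ᶠ q : ℕ in atTop, 0 ≤ ω q) (hα : ∀ᶠ q in atTop, 0 ≤ α q)
    (hακ : ∀ᶠ q : ℕ in atTop, α q + κ * (q : ℝ) ^ (-σ) ≤ (q : ℝ) ^ (-τ))
    (hB : Tendsto B atTop atTop)
    (hBσ : Tendsto (fun q : ℕ => B q ^ (-τ) * (q : ℝ) ^ σ) atTop (𝓝 0))
    (havoids : ∀ᶠ q : ℕ in atTop, ∀ r : ℚ, r.den = q →
      ∀ x ∈ cell α (fun q => κ * (q : ℝ) ^ (-σ)) r, ∀ b : ℕ, q ≤ b → b ≤ B q →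
        AvoidsDen (fun q => q ^ (-τ)) ω x b) :
    ENNReal.ofReal (2 / σ) ≤ dimH (exactOrder (fun q => q ^ (-τ)) ω) := by
  refine le_dimH_exactOrder_of_admissibleDen (α := α) (B := B) hτ hκ hσ ?_
  filter_upwards [hω, hα, hακ, eventually_volume_Icc_inter_nearLargeDen_le hτ hκ hB hBσ, havoids]
    with q h₁ h₂ h₃ h₄ h₅
  exact ⟨h₁, h₂, h₃, h₄, h₅⟩

end Cells

section Avoidance

theorem rpow_neg_le_half_of_two_mul_le {τ u v : ℝ} (hτ : 1 ≤ τ) (hu : 0 < u) (huv : 2 * u ≤ v) :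
    v ^ (-τ) ≤ u ^ (-τ) / 2 :=
  calc v ^ (-τ) ≤ (2 * u) ^ (-τ) :=
        Real.rpow_le_rpow_of_nonpos (by positivity) huv (by linarith)
    _ = 2 ^ (-τ) * u ^ (-τ) := Real.mul_rpow two_pos.le hu.le
    _ ≤ 2 ^ (-1 : ℝ) * u ^ (-τ) := by
        gcongr
        exact one_le_two
    _ = u ^ (-τ) / 2 := by rw [Real.rpow_neg_one, inv_mul_eq_div]

theorem avoidsDen_of_le_rpow_den {τ x : ℝ} {ω : ℝ → ℝ} {r : ℚ} {b : ℕ} (hτ : 2 < τ)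
    (hωb : 0 ≤ ω b) (hωr : ω r.den ≤ 1 / 2) (hden : 2 ≤ (r.den : ℝ) ^ (τ - 2))
    (hlo : (1 - ω r.den) * (r.den : ℝ) ^ (-τ) ≤ |x - r|) (hhi : |x - r| ≤ (r.den : ℝ) ^ (-τ))
    (hrb : r.den ≤ b) (hbr : (b : ℝ) ≤ (r.den : ℝ) ^ (τ - 1) / 2) :
    AvoidsDen (fun q => q ^ (-τ)) ω x b := by
  have hq : (0 : ℝ) < r.den := by exact_mod_cast r.den_pos
  have hb : 0 < b := r.den_pos.trans_le hrb
  have hrb' : (r.den : ℝ) ≤ b := by exact_mod_cast hrb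
  have hle : (1 - ω b) * (b : ℝ) ^ (-τ) ≤ (b : ℝ) ^ (-τ) :=
    mul_le_of_le_one_left (by positivity) (sub_le_self 1 hωb)
  have hexp : τ - 1 = τ - 2 + 1 := by ring
  intro a
  by_cases ha : (a : ℝ) / b = r
  · rw [ha]
    obtain ⟨k, rfl⟩ := den_dvd_of_div_eq ha
    rcases Nat.lt_or_ge k 2 with hk | hk
    · obtain rfl : k = 1 := by
        have := pos_of_mul_pos_right hb r.den.zero_le
        omega
      simpa only [mul_one] using hlo
    · have hhalf : ((r.den * k : ℕ) : ℝ) ^ (-τ) ≤ (r.den : ℝ) ^ (-τ) / 2 := by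
        refine rpow_neg_le_half_of_two_mul_le (by linarith) hq ?_
        exact_mod_cast (mul_comm 2 r.den).trans_le (Nat.mul_le_mul_left _ hk)
      have hτq : 0 ≤ (r.den : ℝ) ^ (-τ) := by positivity
      linarith [mul_le_mul_of_nonneg_right hωr hτq]
  · refine hle.trans (rpow_neg_le_abs_sub_div hb ha (hhi.trans ?_) ?_)
    · rw [le_div_iff₀ two_pos, Real.rpow_sub_one hq.ne', le_div_iff₀ hq] at hbr
      rw [Real.rpow_neg hq.le, ← one_div]
      exact one_div_le_one_div_of_le (by positivity) (by linarith)
    · calc 2 * (r.den : ℝ) ≤ (r.den : ℝ) ^ (τ - 2) * r.den := by gcongr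
        _ = (r.den : ℝ) ^ (τ - 1) := by rw [hexp, Real.rpow_add_one hq.ne']
        _ ≤ (b : ℝ) ^ (τ - 1) := Real.rpow_le_rpow hq.le hrb' (by linarith)

theorem rpow_neg_le_abs_sub_div_of_rpow_neg_den_le {τ x : ℝ} {r : ℚ} {a : ℤ} {b : ℕ} (hτ : 0 ≤ τ)
    (hb : 0 < b) (hlo : (r.den : ℝ) ^ (-τ) ≤ |x - r|) (hhi : |x - r| ≤ 1 / (2 * (b * r.den)))
    (hden : 2 * (r.den : ℝ) ≤ (b : ℝ) ^ (τ - 1)) : (b : ℝ) ^ (-τ) ≤ |x - (a : ℝ) / b| := by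
  by_cases ha : (a : ℝ) / b = r
  · rw [ha]
    refine le_trans ?_ hlo
    exact Real.rpow_le_rpow_of_nonpos (by exact_mod_cast r.den_pos)
      (by exact_mod_cast Nat.le_of_dvd hb (den_dvd_of_div_eq ha)) (neg_nonpos.2 hτ)
  · exact rpow_neg_le_abs_sub_div hb ha hhi hden

end Avoidance

section LowerBound

theorem tendsto_rpow_div_rpow_neg_mul_rpow {e D τ σ : ℝ} (hD : 0 < D) (hσ : σ < e * τ) :
    Tendsto (fun q : ℕ => ((q : ℝ) ^ e / D) ^ (-τ) * (q : ℝ) ^ σ) atTop (𝓝 0) := by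
  have hlim : Tendsto (fun q : ℕ => D ^ τ * (q : ℝ) ^ (-(e * τ - σ))) atTop (𝓝 (D ^ τ * 0)) :=
    ((tendsto_rpow_neg_atTop (sub_pos.2 hσ)).comp tendsto_natCast_atTop_atTop).const_mul _
  rw [mul_zero] at hlim
  refine hlim.congr' ?_
  filter_upwards [eventually_gt_atTop 0] with q hq
  have hq' : (0 : ℝ) < q := by exact_mod_cast hq
  rw [Real.div_rpow (by positivity) hD.le, ← Real.rpow_mul hq'.le, Real.rpow_neg hD.le,
    div_inv_eq_mul, mul_right_comm, ← Real.rpow_add hq', mul_comm]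
  congr 2
  ring

theorem tendsto_rpow_div_atTop {e D : ℝ} (he : 0 < e) (hD : 0 < D) :
    Tendsto (fun q : ℕ => (q : ℝ) ^ e / D) atTop atTop :=
  ((tendsto_rpow_atTop he).comp tendsto_natCast_atTop_atTop).atTop_div_const hD

theorem tendsto_const_mul_rpow_neg (A : ℝ) {e : ℝ} (he : 0 < e) :
    Tendsto (fun q : ℕ => A * (q : ℝ) ^ (-e)) atTop (𝓝 0) := by
  simpa only [mul_zero, Function.comp_apply] using
    ((tendsto_rpow_neg_atTop he).comp tendsto_natCast_atTop_atTop).const_mul A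

theorem le_dimH_exactOrder_const_mul_rpow {τ τ₂ A κ : ℝ} {B : ℕ → ℝ} (hτ : 2 < τ) (hτ₂ : 0 < τ₂)
    (hκ : 0 < κ) (hκA : κ ≤ A) (hB : Tendsto B atTop atTop)
    (hBτ : Tendsto (fun q : ℕ => B q ^ (-τ) * (q : ℝ) ^ (τ + τ₂)) atTop (𝓝 0))
    (havoids : ∀ᶠ q : ℕ in atTop, ∀ r : ℚ, r.den = q → ∀ x : ℝ,
      (1 - A * (q : ℝ) ^ (-τ₂)) * (q : ℝ) ^ (-τ) ≤ x - r →
      x - r ≤ (q : ℝ) ^ (-τ) - (A - κ) * (q : ℝ) ^ (-(τ + τ₂)) → ∀ b : ℕ, q ≤ b → b ≤ B q →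
        AvoidsDen (fun q => q ^ (-τ)) (fun q => A * q ^ (-τ₂)) x b) :
    ENNReal.ofReal (2 / (τ + τ₂)) ≤
      dimH (exactOrder (fun q => q ^ (-τ)) (fun q => A * q ^ (-τ₂))) := by
  have hA : 0 < A := hκ.trans_le hκA
  have hright : ∀ᶠ q : ℕ in atTop, (1 - A * (q : ℝ) ^ (-τ₂)) * (q : ℝ) ^ (-τ) +
      κ * (q : ℝ) ^ (-(τ + τ₂)) = (q : ℝ) ^ (-τ) - (A - κ) * (q : ℝ) ^ (-(τ + τ₂)) := by
    filter_upwards [eventually_gt_atTop 0] with q hq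
    rw [neg_add_rev, Real.rpow_add (by exact_mod_cast hq)]
    ring
  refine le_dimH_exactOrder (α := fun q => (1 - A * (q : ℝ) ^ (-τ₂)) * (q : ℝ) ^ (-τ)) hτ hκ
    (by linarith) (.of_forall fun q => by positivity) ?_ ?_ hB hBτ ?_
  · filter_upwards [(tendsto_const_mul_rpow_neg A hτ₂).eventually_le_const one_pos] with q hq
    exact mul_nonneg (sub_nonneg.2 hq) (by positivity)
  · filter_upwards [hright] with q hq
    rw [hq]
    exact sub_le_self _ (mul_nonneg (sub_nonneg.2 hκA) (by positivity))
  · filter_upwards [hright, havoids] with q hq hq' r hr x hx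
    subst hr
    rw [cell, add_assoc, hq] at hx
    exact hq' r rfl x (by linarith [hx.1]) (by linarith [hx.2])

theorem eventually_forall_avoidsDen {τ : ℝ} {ω : ℝ → ℝ} (hτ : 2 < τ)
    (hω : ∀ᶠ q : ℕ in atTop, 0 ≤ ω q) (hω₀ : Tendsto (fun q : ℕ => ω q) atTop (𝓝 0)) :
    ∀ᶠ q : ℕ in atTop, ∀ r : ℚ, r.den = q → ∀ x : ℝ, (1 - ω q) * (q : ℝ) ^ (-τ) ≤ x - r →
      x - r ≤ (q : ℝ) ^ (-τ) → ∀ b : ℕ, q ≤ b → (b : ℝ) ≤ (q : ℝ) ^ (τ - 1) / 2 →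
        AvoidsDen (fun q => q ^ (-τ)) ω x b := by
  filter_upwards [eventually_forall_ge_atTop.2 hω, hω₀.eventually_le_const one_half_pos,
    ((tendsto_rpow_atTop (sub_pos.2 hτ)).comp
      tendsto_natCast_atTop_atTop).eventually_ge_atTop 2] with q hω hωq hq r hr x hlo hhi b hqb hbq
  subst hr
  have hx : 0 ≤ x - r := le_trans (mul_nonneg (by linarith) (by positivity)) hlo
  rw [← abs_of_nonneg hx] at hlo hhi
  exact avoidsDen_of_le_rpow_den hτ (hω b hqb) hωq hq hlo hhi hqb hbq

theorem le_dimH_exactOrder_of_lt_mul_sub_two {τ τ₂ A : ℝ} (hτ : 2 < τ) (hA : 0 < A)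
    (hτ₂ : 0 < τ₂) (hlt : τ₂ < τ * (τ - 2)) :
    ENNReal.ofReal (2 / (τ + τ₂)) ≤
      dimH (exactOrder (fun q => q ^ (-τ)) (fun q => A * q ^ (-τ₂))) := by
  refine le_dimH_exactOrder_const_mul_rpow hτ hτ₂ hA le_rfl
    (tendsto_rpow_div_atTop (e := τ - 1) (by linarith) two_pos)
    (tendsto_rpow_div_rpow_neg_mul_rpow two_pos (by nlinarith)) ?_
  filter_upwards [eventually_forall_avoidsDen (ω := fun q => A * q ^ (-τ₂)) hτ
    (.of_forall fun q => by positivity) (tendsto_const_mul_rpow_neg A hτ₂)] with q hq r hr x hlo hhi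
  rw [sub_self, zero_mul, sub_zero] at hhi
  exact hq r hr x hlo hhi

theorem eventually_two_mul_pow_le_rpow {n : ℕ} (hn : 3 ≤ n) : ∀ᶠ q : ℕ in atTop,
    2 * (q : ℝ) ^ n ≤ ((q : ℝ) ^ ((n : ℝ) - 1) / 2) ^ ((n : ℝ) - 1) := by
  have hn' : (3 : ℝ) ≤ n := by exact_mod_cast hn
  have hlarge : ∀ᶠ q : ℕ in atTop, 2 * 2 ^ ((n : ℝ) - 1) ≤
      (q : ℝ) ^ (((n : ℝ) - 1) * ((n : ℝ) - 1) - n) :=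
    ((tendsto_rpow_atTop (by nlinarith)).comp tendsto_natCast_atTop_atTop).eventually_ge_atTop _
  filter_upwards [hlarge, eventually_gt_atTop 0] with q hlarge hq
  have hq' : (0 : ℝ) < q := by exact_mod_cast hq
  rw [Real.rpow_sub hq', le_div_iff₀ (by positivity), Real.rpow_natCast] at hlarge
  rw [Real.div_rpow (by positivity) two_pos.le, ← Real.rpow_mul hq'.le,
    le_div_iff₀ (by positivity)]
  linarith

theorem rpow_neg_le_abs_sub_div_of_le_sub_inv_pow {n : ℕ} (hn : 2 ≤ n) {x δ : ℝ} {r : ℚ} {a : ℤ}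
    {b : ℕ} (hb : 0 < b) (hlo : ((r.den : ℝ) ^ n)⁻¹ - δ ≤ x - r)
    (hhi : x - r ≤ ((r.den : ℝ) ^ n)⁻¹ - (r.den : ℝ) ^ (-((n : ℝ) * n)))
    (hδ : δ ≤ 1 / (2 * (b * (r.den : ℝ) ^ n)))
    (hden : 2 * (r.den : ℝ) ^ n ≤ (b : ℝ) ^ ((n : ℝ) - 1)) :
    (b : ℝ) ^ (-(n : ℝ)) ≤ |x - (a : ℝ) / b| := by
  have hq : (0 : ℝ) < r.den := by exact_mod_cast r.den_pos
  have hpos : 0 < (r.den : ℝ) ^ (-((n : ℝ) * n)) := by positivity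
  have hcast : ((r.den : ℝ) ^ n) ^ (-(n : ℝ)) = (r.den : ℝ) ^ (-((n : ℝ) * n)) := by
    rw [← Real.rpow_natCast, ← Real.rpow_mul hq.le, mul_neg]
  refine rpow_neg_le_abs_sub_div_of_rpow_neg_den_le (r := r + ((r.den : ℚ) ^ n)⁻¹)
    n.cast_nonneg hb ?_ ?_ ?_ <;> rw [den_add_inv_pow hn] <;> push_cast
  · rw [hcast, abs_of_neg (by linarith)]
    linarith
  · rw [abs_of_neg (by linarith)]
    linarith
  · exact hden

theorem le_dimH_exactOrder_natCast {n : ℕ} (hn : 3 ≤ n) {A τ₂ κ : ℝ} (hκ : 0 < κ)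
    (hτ₂ : (n : ℝ) * ((n : ℝ) - 2) ≤ τ₂)
    (hgap : ∀ᶠ q : ℕ in atTop,
      (q : ℝ) ^ (-((n : ℝ) * n)) ≤ (A - κ) * (q : ℝ) ^ (-((n : ℝ) + τ₂))) :
    ENNReal.ofReal (2 / (n + τ₂)) ≤
      dimH (exactOrder (fun q => q ^ (-(n : ℝ))) (fun q => A * q ^ (-τ₂))) := by
  have hn' : (3 : ℝ) ≤ n := by exact_mod_cast hn
  have hτ₂' : 0 < τ₂ := by nlinarith
  have hκA : κ ≤ A := by
    obtain ⟨q, hq, hq0⟩ := (hgap.and (eventually_gt_atTop 0)).exists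
    exact sub_nonneg.1 (pos_of_mul_pos_left
      ((by positivity : 0 < (q : ℝ) ^ (-((n : ℝ) * n))).trans_le hq) (by positivity)).le
  have hA : 0 < A := hκ.trans_le hκA
  refine le_dimH_exactOrder_const_mul_rpow (by linarith) hτ₂' hκ hκA
    (tendsto_rpow_div_atTop hτ₂' (D := 2 * A) (by positivity))
    (tendsto_rpow_div_rpow_neg_mul_rpow (by positivity) (by nlinarith)) ?_
  filter_upwards [eventually_forall_avoidsDen (ω := fun q => A * q ^ (-τ₂)) (τ := n)
    (by linarith) (.of_forall fun q => by positivity) (tendsto_const_mul_rpow_neg A hτ₂'),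
    eventually_two_mul_pow_le_rpow hn, hgap, eventually_gt_atTop 0]
    with q hshort hlarge hgap hq r hr x hlo hhi b hqb hbB
  have hb : 0 < b := hq.trans_le hqb
  have hpos : 0 < (q : ℝ) ^ (-((n : ℝ) * n)) := by positivity
  rcases le_total (b : ℝ) ((q : ℝ) ^ ((n : ℝ) - 1) / 2) with hbq | hbq
  · exact hshort r hr x hlo (by linarith) b hqb hbq
  refine .of_le (by positivity) (by positivity) fun a => ?_
  subst hr
  rw [Real.rpow_neg r.den.cast_nonneg n, Real.rpow_natCast] at hlo hhi
  rw [le_div_iff₀ (by positivity)] at hbB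
  refine rpow_neg_le_abs_sub_div_of_le_sub_inv_pow
    (δ := A * (r.den : ℝ) ^ (-τ₂) * ((r.den : ℝ) ^ n)⁻¹) (by omega) hb (by linarith) (by linarith)
    ?_ (hlarge.trans (Real.rpow_le_rpow (by positivity) hbq (by linarith)))
  rw [Real.rpow_neg r.den.cast_nonneg, ← div_eq_mul_inv, ← div_eq_mul_inv, div_div,
    div_le_div_iff₀ (by positivity) (by positivity)]
  nlinarith [pow_pos (Nat.cast_pos (α := ℝ).2 hq) n]

end LowerBound

section UpperBound

variable {Ψ ω : ℝ → ℝ} {x : ℝ}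

theorem frequently_of_mem_wellApprox (hx : x ∈ wellApprox Ψ) :
    ∃ᶠ q : ℕ in atTop, 0 < q ∧ ∃ p : ℤ, |x - (p : ℝ) / q| ≤ Ψ q := by
  intro hev
  obtain ⟨Q, hQ⟩ := eventually_atTop.1 hev
  refine hx (((Set.finite_Iio Q).biUnion fun q _ => ((Finset.Icc ⌈(x - Ψ q) * q⌉
    ⌊(x + Ψ q) * q⌋).finite_toSet.image fun p => (p, q))).subset ?_)
  rintro ⟨p, q⟩ ⟨hq, hpq⟩
  have hlt : q < Q := not_le.1 fun hle => hQ q hle ⟨hq, p, hpq⟩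
  exact Set.mem_biUnion hlt
    ⟨p, mem_Icc_ceil_floor_of_abs_sub_div_le hq (Set.left_mem_Icc.2 le_rfl) hpq, rfl⟩

theorem frequently_of_mem_exactOrder (hx : x ∈ exactOrder Ψ ω) :
    ∃ᶠ q : ℕ in atTop, 0 < q ∧ ∃ p : ℤ, |x - (p : ℝ) / q| ≤ Ψ q ∧
      (|x - (p / q + Ψ q)| ≤ ω q * Ψ q ∨ |x - (p / q - Ψ q)| ≤ ω q * Ψ q) :=
  ((frequently_of_mem_wellApprox hx.1).and_eventually hx.2).mono
    fun _ ⟨⟨hq, p, hp⟩, havoids⟩ =>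
      ⟨hq, p, hp, abs_sub_add_le_or_abs_sub_sub_le (havoids p) hp⟩

/-- The centres `p / q ± ψ` of the intervals which cover the points of `[z, z + 1]` whose distance
to some `p / q` is almost `ψ`. -/
noncomputable def shellCentres (ψ : ℝ) (z : ℤ) (q : ℕ) : Finset ℝ :=
  let numerators := Finset.Icc ⌈((z : ℝ) - 1) * q⌉ ⌊((z : ℝ) + 1 + 1) * q⌋
  numerators.image (fun p : ℤ => (p : ℝ) / q + ψ) ∪
    numerators.image (fun p : ℤ => (p : ℝ) / q - ψ)

theorem card_shellCentres_le (ψ : ℝ) (z : ℤ) {q : ℕ} (hq : 0 < q) :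
    ((shellCentres ψ z q).card : ℝ) ≤ 8 * q := by
  have hq' : (1 : ℝ) ≤ q := by exact_mod_cast hq
  have hIcc := card_Icc_ceil_floor_le
    (show ((z : ℝ) - 1) * q ≤ ((z : ℝ) + 1 + 1) * q by gcongr; linarith)
  have hunion : (shellCentres ψ z q).card ≤
      2 * (Finset.Icc ⌈((z : ℝ) - 1) * q⌉ ⌊((z : ℝ) + 1 + 1) * q⌋).card :=
    (Finset.card_union_le _ _).trans <|
      (add_le_add Finset.card_image_le Finset.card_image_le).trans_eq (two_mul _).symm
  rw [← Nat.cast_le (α := ℝ), Nat.cast_mul, Nat.cast_two] at hunion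
  linarith

theorem dimH_exactOrder_le {A σ : ℝ} (hA : 0 ≤ A) (hσ : 0 < σ)
    (h : ∀ᶠ q : ℕ in atTop, Ψ q ≤ 1 ∧ ω q * Ψ q ≤ A * (q : ℝ) ^ (-σ)) :
    dimH (exactOrder Ψ ω) ≤ ENNReal.ofReal (2 / σ) := by
  have hcover : exactOrder Ψ ω ⊆ ⋃ z : ℤ, exactOrder Ψ ω ∩ Set.Icc (z : ℝ) (z + 1) := fun x hx =>
    Set.mem_iUnion.2 ⟨⌊x⌋, hx, Int.floor_le x, (Int.lt_floor_add_one x).le⟩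
  refine (dimH_mono hcover).trans ?_
  rw [dimH_iUnion, ← one_add_one_eq_two]
  refine iSup_le fun z => (dimH_mono ?_).trans
    (dimH_setOf_frequently_exists_le (S := fun q => shellCentres (Ψ q) z q) (D := 8) hA hσ ?_)
  · rintro x ⟨hx, hxz⟩
    refine ((frequently_of_mem_exactOrder hx).and_eventually h).mono ?_
    rintro q ⟨⟨hq, p, hp, hshell⟩, hΨ, hω⟩
    have hmem := mem_Icc_ceil_floor_of_abs_sub_div_le hq hxz (hp.trans hΨ)
    rcases hshell with hshell | hshell
    · exact ⟨_, Finset.mem_union_left _ (Finset.mem_image_of_mem _ hmem), hshell.trans hω⟩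
    · exact ⟨_, Finset.mem_union_right _ (Finset.mem_image_of_mem _ hmem), hshell.trans hω⟩
  · filter_upwards [eventually_gt_atTop 0] with q hq
    rw [Real.rpow_one]
    exact card_shellCentres_le _ z hq

theorem dimH_exactOrder_const_mul_rpow_le {τ τ₂ A : ℝ} (hτ : 0 < τ) (hτ₂ : 0 < τ₂) (hA : 0 ≤ A) :
    dimH (exactOrder (fun q => q ^ (-τ)) (fun q => A * q ^ (-τ₂))) ≤
      ENNReal.ofReal (2 / (τ + τ₂)) := by
  refine dimH_exactOrder_le hA (by linarith) ?_
  filter_upwards [eventually_ge_atTop 1] with q hq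
  have hq' : (1 : ℝ) ≤ q := by exact_mod_cast hq
  refine ⟨Real.rpow_le_one_of_one_le_of_nonpos hq' (by linarith), ?_⟩
  rw [mul_assoc, ← Real.rpow_add (by linarith), neg_add_rev]

end UpperBound

section Emptiness

theorem exists_abs_sub_div_pow_le {n : ℕ} (hn : 1 ≤ n) {x δ : ℝ} {p : ℤ} {q : ℕ} (hq : 0 < q)
    (h : |x - (p / q + (q : ℝ) ^ (-(n : ℝ)))| ≤ δ ∨ |x - (p / q - (q : ℝ) ^ (-(n : ℝ)))| ≤ δ) :
    ∃ P : ℤ, |x - (P : ℝ) / (q ^ n : ℕ)| ≤ δ := by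
  obtain ⟨k, rfl⟩ := Nat.exists_eq_add_of_le' hn
  have hfrac (s : ℤ) : ((p * q ^ k + s : ℤ) : ℝ) / (q ^ (k + 1) : ℕ)
      = p / q + s * (q : ℝ) ^ (-((k + 1 : ℕ) : ℝ)) := by
    rw [Real.rpow_neg q.cast_nonneg, Real.rpow_natCast]
    push_cast
    field_simp
    ring
  rcases h with h | h
  · exact ⟨p * q ^ k + 1, by rwa [hfrac, Int.cast_one, one_mul]⟩
  · exact ⟨p * q ^ k + -1, by
      rwa [hfrac, Int.cast_neg, Int.cast_one, neg_one_mul, ← sub_eq_add_neg]⟩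

theorem exactOrder_natCast_eq_empty {n : ℕ} (hn : 2 ≤ n) {c : ℝ} (hc : c < 1) :
    exactOrder (fun q => q ^ (-(n : ℝ))) (fun q => c * q ^ (-((n : ℝ) * ((n : ℝ) - 1)))) = ∅ := by
  have hn' : (2 : ℝ) ≤ n := by exact_mod_cast hn
  refine Set.eq_empty_iff_forall_notMem.2 fun x hx => ?_
  have hpow : Tendsto (fun q : ℕ => q ^ n) atTop atTop := tendsto_pow_atTop (by omega)
  have hω := hpow.eventually ((tendsto_const_mul_rpow_neg c
    (show 0 < (n : ℝ) * ((n : ℝ) - 1) by nlinarith)).eventually_lt_const (sub_pos.2 hc))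
  obtain ⟨q, ⟨hq, p, -, hshell⟩, hω, havoids⟩ :=
    ((frequently_of_mem_exactOrder hx).and_eventually (hω.and (hpow.eventually hx.2))).exists
  have hq' : (0 : ℝ) < q := by exact_mod_cast hq
  have hΨ : (((q ^ n : ℕ) : ℝ)) ^ (-(n : ℝ)) = (q : ℝ) ^ (-((n : ℝ) * n)) := by
    rw [Nat.cast_pow, ← Real.rpow_natCast, ← Real.rpow_mul hq'.le, mul_neg]
  have hωΨ : c * (q : ℝ) ^ (-((n : ℝ) * ((n : ℝ) - 1))) * (q : ℝ) ^ (-(n : ℝ))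
      = c * (q : ℝ) ^ (-((n : ℝ) * n)) := by
    rw [mul_assoc, ← Real.rpow_add hq']
    congr 2
    ring
  rw [hωΨ] at hshell
  obtain ⟨P, hP⟩ := exists_abs_sub_div_pow_le (by omega) hq hshell
  have hle := (havoids P).trans hP
  beta_reduce at hle
  rw [hΨ] at hle
  have hle' := (mul_le_mul_iff_of_pos_right (by positivity)).1 hle
  linarith

end Emptiness

section Dimension

theorem dimH_exactOrder_of_lt_mul_sub_two {τ τ₂ A : ℝ} (hτ : 2 < τ) (hA : 0 < A) (hτ₂ : 0 < τ₂)
    (hlt : τ₂ < τ * (τ - 2)) :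
    dimH (exactOrder (fun q => q ^ (-τ)) (fun q => A * q ^ (-τ₂))) =
      ENNReal.ofReal (2 / (τ + τ₂)) :=
  le_antisymm (dimH_exactOrder_const_mul_rpow_le (by linarith) hτ₂ hA.le)
    (le_dimH_exactOrder_of_lt_mul_sub_two hτ hA hτ₂ hlt)

theorem dimH_exactOrder_natCast_of_lt {n : ℕ} (hn : 3 ≤ n) {A τ₂ : ℝ} (hA : 0 < A) (hτ₂ : 0 < τ₂)
    (hlt : τ₂ < n * ((n : ℝ) - 1)) :
    dimH (exactOrder (fun q => q ^ (-(n : ℝ))) (fun q => A * q ^ (-τ₂))) =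
      ENNReal.ofReal (2 / (n + τ₂)) := by
  have hn' : (3 : ℝ) ≤ n := by exact_mod_cast hn
  rcases lt_or_ge τ₂ ((n : ℝ) * ((n : ℝ) - 2)) with hsmall | hlarge
  · exact dimH_exactOrder_of_lt_mul_sub_two (by linarith) hA hτ₂ hsmall
  refine le_antisymm (dimH_exactOrder_const_mul_rpow_le (by linarith) hτ₂ hA.le)
    (le_dimH_exactOrder_natCast hn (half_pos hA) hlarge ?_)
  have hgap : ∀ᶠ q : ℕ in atTop, (A / 2)⁻¹ ≤ (q : ℝ) ^ ((n : ℝ) * n - (n + τ₂)) :=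
    ((tendsto_rpow_atTop (by linarith)).comp tendsto_natCast_atTop_atTop).eventually_ge_atTop _
  filter_upwards [hgap, eventually_gt_atTop 0] with q hgap hq
  have hq' : (0 : ℝ) < q := by exact_mod_cast hq
  rw [inv_le_iff_one_le_mul₀' (by positivity)] at hgap
  calc (q : ℝ) ^ (-((n : ℝ) * n))
      ≤ A / 2 * (q : ℝ) ^ ((n : ℝ) * n - (n + τ₂)) * (q : ℝ) ^ (-((n : ℝ) * n)) :=
        le_mul_of_one_le_left (by positivity) hgap
    _ = (A - A / 2) * (q : ℝ) ^ (-((n : ℝ) + τ₂)) := by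
        rw [mul_assoc, ← Real.rpow_add hq', sub_half]
        ring_nf

theorem dimH_exactOrder_natCast_critical {n : ℕ} (hn : 3 ≤ n) {C : ℝ} (hC : 1 < C) :
    dimH (exactOrder (fun q => q ^ (-(n : ℝ))) (fun q => C * q ^ (-((n : ℝ) * ((n : ℝ) - 1))))) =
      ENNReal.ofReal (2 / (n : ℝ) ^ 2) := by
  have hn' : (3 : ℝ) ≤ n := by exact_mod_cast hn
  have hsum : (n : ℝ) + n * (n - 1) = n * n := by ring
  rw [sq, ← hsum]
  refine le_antisymm
    (dimH_exactOrder_const_mul_rpow_le (by linarith) (by nlinarith) (by linarith))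
    (le_dimH_exactOrder_natCast hn (sub_pos.2 hC) (by nlinarith) (.of_forall fun q => ?_))
  rw [hsum, sub_sub_cancel, one_mul]

end Dimension

end ExactApprox

theorem mainTheorem7_general {τ : ℝ} (hτ : 2 < τ) :
    (∀ A τ₂ : ℝ, 0 < A → 0 < τ₂ → τ₂ < τ * (τ - 2) →
      dimH (ExactApprox.exactOrder (fun q : ℝ => q ^ (-τ)) (fun q : ℝ => A * q ^ (-τ₂)))
        = ENNReal.ofReal (2 / (τ + τ₂))) ∧
    ((∃ n : ℕ, τ = n) →
      (∀ A τ₂ : ℝ, 0 < A → 0 < τ₂ → τ₂ < τ * (τ - 1) →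
        dimH (ExactApprox.exactOrder (fun q : ℝ => q ^ (-τ)) (fun q : ℝ => A * q ^ (-τ₂)))
          = ENNReal.ofReal (2 / (τ + τ₂))) ∧
      (∀ C : ℝ, 1 < C →
        dimH (ExactApprox.exactOrder (fun q : ℝ => q ^ (-τ))
            (fun q : ℝ => C * q ^ (-(τ * (τ - 1)))))
          = ENNReal.ofReal (2 / τ ^ 2)) ∧
      (∀ c : ℝ, c < 1 →
        ExactApprox.exactOrder (fun q : ℝ => q ^ (-τ))
            (fun q : ℝ => c * q ^ (-(τ * (τ - 1)))) = ∅)) := by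
  refine ⟨fun A τ₂ => ExactApprox.dimH_exactOrder_of_lt_mul_sub_two hτ, ?_⟩
  rintro ⟨n, rfl⟩
  have hn : 3 ≤ n := by exact_mod_cast hτ
  exact ⟨fun A τ₂ => ExactApprox.dimH_exactOrder_natCast_of_lt hn,
    fun C => ExactApprox.dimH_exactOrder_natCast_critical hn,
    fun c => ExactApprox.exactOrder_natCast_eq_empty (by omega)⟩

theorem mainTheorem7 (τ₁ : ℝ) (hτ₁ : 2 < τ₁) :
    (∀ τ₂ : ℝ, 0 < τ₂ → τ₂ < τ₁ * (τ₁ - 2) →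
      dimH (ExactApprox.exactOrder (fun q : ℝ => q ^ (-τ₁)) (fun q : ℝ => q ^ (-τ₂)))
        = ENNReal.ofReal (2 / (τ₁ + τ₂))) ∧
    ((∃ n : ℕ, 3 ≤ n ∧ τ₁ = (n : ℝ)) →
      (∀ τ₂ : ℝ, 0 < τ₂ → τ₂ < τ₁ * (τ₁ - 1) →
        dimH (ExactApprox.exactOrder (fun q : ℝ => q ^ (-τ₁)) (fun q : ℝ => q ^ (-τ₂)))
          = ENNReal.ofReal (2 / (τ₁ + τ₂))) ∧
      (∀ C : ℝ, (45 / 16 : ℝ) * (8 : ℝ) ^ τ₁ < C →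
        dimH (ExactApprox.exactOrder (fun q : ℝ => q ^ (-τ₁))
            (fun q : ℝ => C * q ^ (-(τ₁ * (τ₁ - 1)))))
          = ENNReal.ofReal (2 / τ₁ ^ 2)) ∧
      (∀ c : ℝ, 0 < c → c < 1 →
        ExactApprox.exactOrder (fun q : ℝ => q ^ (-τ₁))
            (fun q : ℝ => c * q ^ (-(τ₁ * (τ₁ - 1)))) = ∅)) := by
  obtain ⟨hreal, hint⟩ := mainTheorem7_general hτ₁
  refine ⟨fun τ₂ => by simpa only [one_mul] using hreal 1 τ₂ one_pos, fun ⟨n, _, hn⟩ => ?_⟩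
  obtain ⟨hsub, hcrit, hempty⟩ := hint ⟨n, hn⟩
  refine ⟨fun τ₂ => by simpa only [one_mul] using hsub 1 τ₂ one_pos, fun C hC => hcrit C ?_,
    fun c _ => hempty c⟩
  linarith [Real.one_le_rpow (show (1 : ℝ) ≤ 8 by norm_num) (zero_le_two.trans hτ₁.le)]
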